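/- There is a strongly polynomial algorithm that, given any $n \ge 0$ and any rational symmetric $n \times n$ matrix $H$, finds an invertible rational $n \times n$ matrix $L$ and a diagonal rational $n \times n$ matrix $D$ such that $$H = L D L^{\mathsf T}, \qquad \|L\|_F \le (5n)^{n/2}, \qquad \|L^{-1}\|_F \le (5n)^{n/2},$$ where $\|A\|_F = \sqrt{\sum_{i,j} A_{ij}^2}$ is the Frobenius norm (and $0^0 = 1$ for $n=0$). Here \emph{strongly polynomial} means that a single program for a random access machine over $\mathbb Q$, independent of $n$ and $H$, solves all instances, and that there are polynomials $p, q$ such that on input $H$: (i) (arithmetic model) the program halts after at most $p(n)$ steps, where each elementary arithmetic operation ($+,-,\times,/$) or assignment on rational numbers, each comparison of two rational numbers, and each addition, subtraction, assignment or comparison of indices counts as one step; (ii) (bit model, polynomial space) at every moment of the run the number of bits needed to write down the whole memory, with rationals as reduced fractions in binary and every nonzero cell together with its address, is at most $q(\langle H\rangle)$, where $\langle H\rangle$ is the total binary encoding length of the entries of $H$. -/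

import Mathlib

/-!
# A random access machine over the rationals

This is the arithmetic model of computation: a program works on finitely many named index
registers (holding natural numbers) and on named two-dimensional arrays of rational numbers.
One elementary arithmetic operation, one copy, or one comparison is one step.
At the same time the number of bits needed to write down the complete memory in binary (every
rational as a reduced fraction, every nonzero cell together with its address) is recorded at
every moment of the run; its maximum is the space used by the computation.
-/

namespace RatRAM

/-- A reference to the rational cell `array[row, col]`; `array` is a fixed array name, while `row`
and `col` are the names of the index registers that hold the two coordinates (so that the address
is computed at run time). -/
structure Ref where
  array : ℕ
  row : ℕ
  col : ℕ

/-- A right-hand side for an index register: a constant, a copy of an index register, or one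
operation on two index registers (given by their names). -/
inductive IdxExpr where
  | const (c : ℕ)
  | reg (i : ℕ)
  | add (i j : ℕ)
  | sub (i j : ℕ)

/-- A right-hand side for a rational cell: a constant, a copy of a cell, or one elementary
arithmetic operation on two cells. -/
inductive RatExpr where
  | const (c : ℚ)
  | cell (a : Ref)
  | add (a b : Ref)
  | sub (a b : Ref)
  | mul (a b : Ref)
  | div (a b : Ref)

/-- The comparisons of two index registers and of two rational cells. -/
inductive Test where
  | idxLt (i j : ℕ)
  | ratLe (a b : Ref)

/-- Programs. A program is a fixed finite text: it does not depend on the input. -/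
inductive Program where
  | skip
  | setIdx (i : ℕ) (e : IdxExpr)
  | setRat (a : Ref) (e : RatExpr)
  | seq (P Q : Program)
  | ite (b : Test) (P Q : Program)
  | loop (b : Test) (P : Program)

/-- The memory of the machine: the contents of the index registers and of the rational cells
(array name, row, column). All but finitely many are zero. -/
structure State where
  idx : ℕ →₀ ℕ
  mem : ℕ × ℕ × ℕ →₀ ℚ

/-- The binary encoding length of a rational number: one bit for the sign, and the binary lengths
of numerator and denominator of the reduced fraction. -/
def ratBits (r : ℚ) : ℕ := 1 + Nat.size r.num.natAbs + Nat.size r.den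

/-- The binary encoding length of a rational matrix. -/
def matrixBits {n : ℕ} (H : Matrix (Fin n) (Fin n) ℚ) : ℕ := ∑ i, ∑ j, ratBits (H i j)

/-- The binary encoding length of the memory, as a list of all nonzero registers and cells, each
with its address and its contents. -/
def State.bits (σ : State) : ℕ :=
  (∑ i ∈ σ.idx.support, (Nat.size i + Nat.size (σ.idx i))) +
    ∑ a ∈ σ.mem.support,
      (Nat.size a.1 + Nat.size a.2.1 + Nat.size a.2.2 + ratBits (σ.mem a))

/-- The address that a reference denotes in a given state. -/
def State.addr (σ : State) (a : Ref) : ℕ × ℕ × ℕ := (a.array, σ.idx a.row, σ.idx a.col)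

/-- The contents of the cell that a reference denotes in a given state. -/
def State.get (σ : State) (a : Ref) : ℚ := σ.mem (σ.addr a)

/-- The value of a right-hand side (subtraction of indices is truncated at zero). -/
def IdxExpr.eval (σ : State) : IdxExpr → ℕ
  | .const c => c
  | .reg i => σ.idx i
  | .add i j => σ.idx i + σ.idx j
  | .sub i j => σ.idx i - σ.idx j

/-- The value of a right-hand side; a division by zero has no value. -/
def RatExpr.eval (σ : State) : RatExpr → Option ℚ
  | .const c => some c
  | .cell a => some (σ.get a)
  | .add a b => some (σ.get a + σ.get b)
  | .sub a b => some (σ.get a - σ.get b)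
  | .mul a b => some (σ.get a * σ.get b)
  | .div a b => if σ.get b = 0 then none else some (σ.get a / σ.get b)

/-- The truth of a comparison in a given state. -/
def Test.Holds (σ : State) : Test → Prop
  | .idxLt i j => σ.idx i < σ.idx j
  | .ratLe a b => σ.get a ≤ σ.get b

/-- The state after the assignment of `v` to the index register `i`. -/
noncomputable def State.updateIdx (σ : State) (i v : ℕ) : State :=
  ⟨σ.idx.update i v, σ.mem⟩

/-- The state after the assignment of `v` to the cell denoted by `a`. -/
noncomputable def State.updateRat (σ : State) (a : Ref) (v : ℚ) : State :=
  ⟨σ.idx, σ.mem.update (σ.addr a) v⟩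

/-- `Exec P σ t s τ`: started in state `σ`, the program `P` halts in state `τ` after exactly `t`
steps (assignments and comparisons), and `s` is the maximum of the encoding lengths of all states
visited during the run. A run that attempts a division by zero gets stuck and never halts. -/
inductive Exec : Program → State → ℕ → ℕ → State → Prop
  | skip (σ : State) : Exec .skip σ 1 σ.bits σ
  | setIdx (σ : State) (i : ℕ) (e : IdxExpr) :
      Exec (.setIdx i e) σ 1 (max σ.bits (σ.updateIdx i (e.eval σ)).bits)
        (σ.updateIdx i (e.eval σ))
  | setRat (σ : State) (a : Ref) (e : RatExpr) (v : ℚ) (hv : e.eval σ = some v) :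
      Exec (.setRat a e) σ 1 (max σ.bits (σ.updateRat a v).bits) (σ.updateRat a v)
  | seq (P Q : Program) (σ τ υ : State) (t₁ t₂ s₁ s₂ : ℕ)
      (hP : Exec P σ t₁ s₁ τ) (hQ : Exec Q τ t₂ s₂ υ) :
      Exec (.seq P Q) σ (t₁ + t₂) (max s₁ s₂) υ
  | iteTrue (b : Test) (P Q : Program) (σ τ : State) (t s : ℕ) (hb : b.Holds σ)
      (hP : Exec P σ t s τ) : Exec (.ite b P Q) σ (t + 1) s τ
  | iteFalse (b : Test) (P Q : Program) (σ τ : State) (t s : ℕ) (hb : ¬ b.Holds σ)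
      (hQ : Exec Q σ t s τ) : Exec (.ite b P Q) σ (t + 1) s τ
  | loopFalse (b : Test) (P : Program) (σ : State) (hb : ¬ b.Holds σ) :
      Exec (.loop b P) σ 1 σ.bits σ
  | loopTrue (b : Test) (P : Program) (σ τ υ : State) (t₁ t₂ s₁ s₂ : ℕ) (hb : b.Holds σ)
      (hP : Exec P σ t₁ s₁ τ) (hQ : Exec (.loop b P) τ t₂ s₂ υ) :
      Exec (.loop b P) σ (t₁ + t₂ + 1) (max s₁ s₂) υ

/-- The initial state on input `H`: the dimension `n` is in index register `0`, the matrix `H` is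
in array `0` (rows and columns numbered from `0`), and everything else is zero. -/
noncomputable def State.input {n : ℕ} (H : Matrix (Fin n) (Fin n) ℚ) : State where
  idx := Finsupp.single 0 n
  mem := ∑ i : Fin n, ∑ j : Fin n, Finsupp.single (0, (i : ℕ), (j : ℕ)) (H i j)

/-- The `n × n` matrix stored in the array with the given name. -/
def State.matrix (σ : State) (n array : ℕ) : Matrix (Fin n) (Fin n) ℚ :=
  Matrix.of fun i j => σ.mem (array, (i : ℕ), (j : ℕ))

/-- `P` is a strongly polynomial algorithm that finds, for every matrix `H` (of any dimension `n`)
with `Valid H`, a pair of matrices `L, D` with `Spec H L D`: it halts with `L` in array `1` and `D`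
in array `2`, the number of its steps in the arithmetic model is at most a polynomial in `n`, and
the space that it uses in the bit model is at most a polynomial in the binary encoding length of
`H`. Both polynomials depend on `P` alone. -/
def Program.FindsInStronglyPolynomialTime (P : Program)
    (Valid : ∀ {n : ℕ}, Matrix (Fin n) (Fin n) ℚ → Prop)
    (Spec : ∀ {n : ℕ}, Matrix (Fin n) (Fin n) ℚ → Matrix (Fin n) (Fin n) ℚ →
      Matrix (Fin n) (Fin n) ℚ → Prop) : Prop :=
  ∃ p q : Polynomial ℕ, ∀ (n : ℕ) (H : Matrix (Fin n) (Fin n) ℚ), Valid H →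
    ∃ (t s : ℕ) (τ : State), Exec P (State.input H) t s τ ∧
      t ≤ p.eval n ∧ s ≤ q.eval (matrixBits H) ∧ Spec H (τ.matrix n 1) (τ.matrix n 2)

end RatRAM

/-- The Frobenius norm of a rational matrix, as a real number. -/
noncomputable def frobeniusNorm {n : ℕ} (A : Matrix (Fin n) (Fin n) ℚ) : ℝ :=
  Real.sqrt (∑ i, ∑ j, (A i j : ℝ) ^ 2)

/-!
The decomposition is symmetric Gaussian elimination with complete pivoting, in which every pivot is
a diagonal entry. Let `W` be the current matrix and let `W p q`, `p ≤ q`, be an entry of largest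
absolute value in the trailing block. If `p = q`, it is the pivot. Otherwise `e_p ± e_q`, with the
sign of `(W p p + W q q) * W p q`, gives a diagonal entry of absolute value at least `2 |W p q|`,
which dominates its row (`RatRAM.pivot_dominates`). An exchange with a sign moves the pivot to
row `k`, and the elimination then uses only multipliers of absolute value at most one. So a stage at
most triples the largest entry of `M = L⁻¹` and at most doubles the entries of the columns of `L`
that are still to be processed, and there are `n - 1` stages. Hence `|M i j| ≤ 3 ^ (n - 1)` and
`|L i j| ≤ 2 ^ n`, which gives the bounds for the Frobenius norms.

All steps are congruences by transvections, so a stage of the program consists of a search and of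
at most `n + 4` calls to one subroutine (`RatRAM.Program.congruence`), which takes `O(n)` steps.

For the encoding lengths, numbers of small absolute value need a common denominator of polynomial
length. All operations on the rows that are not yet reduced have integral coefficients, except for
the eliminations, which can be collected on the left: `M = X V` with `V` integral and `X` unipotent
and equal to the identity outside the first `k` columns (`RatRAM.Factored`). Therefore `W` arises
from the matrix `V H Vᵀ` by block elimination, its trailing block is a Schur complement, and its
entries have the product of the pivots as a common denominator as soon as `H` is integral
(`integral_schur_complement`); the columns of `L` inherit such a denominator from the multipliers
(`RatRAM.Reduced.exists_den`). Inside a stage every entry is an expression of bounded size in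
the entries at the beginning of the elimination (`RatRAM.Eliminating.formula`).

The program uses the registers `0` for `n`, `1` for the stage `k`, `2` and `3` for the position of
the pivot, `4` and `5` for loop counters, and `6`, `7`, `8` for the constants `1`, `n - 1`, `0`. The
arrays are `0` for `W`, `1` for `L`, `2` for `D`; the cells `(3, 0, 0)`, …, `(7, 0, 0)` hold a
temporary value, the multiplier of a congruence, its negative, the value found by the search, and
zero.

Correctness, running time and space are derived together in a program logic (`RatRAM.WP`) whose
assertions hold only for memories of bounded size (`RatRAM.Good`).
-/

/-! ### Encoding lengths of rational numbers -/

section RatBits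

open RatRAM

theorem Nat.size_mul_le (a b : ℕ) : Nat.size (a * b) ≤ Nat.size a + Nat.size b := by
  rw [Nat.size_le, pow_add]
  exact Nat.mul_lt_mul'' (Nat.lt_size_self a) (Nat.lt_size_self b)

theorem Nat.size_add_le (a b : ℕ) : Nat.size (a + b) ≤ max (Nat.size a) (Nat.size b) + 1 := by
  rw [Nat.size_le, pow_succ]
  have ha := (Nat.lt_size_self a).trans_le
    (Nat.pow_le_pow_right two_pos (le_max_left a.size b.size))
  have hb := (Nat.lt_size_self b).trans_le
    (Nat.pow_le_pow_right two_pos (le_max_right a.size b.size))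
  omega

theorem Nat.size_le_self (a : ℕ) : Nat.size a ≤ a := Nat.size_le.2 Nat.lt_two_pow_self

theorem one_le_size {a : ℕ} (ha : a ≠ 0) : 1 ≤ Nat.size a :=
  Nat.size_pos.2 (Nat.pos_of_ne_zero ha)

/-- Reducing a fraction does not lengthen it. -/
theorem ratBits_le_of_mul_eq {x : ℚ} {d z : ℤ} (hd : d ≠ 0) (h : x * d = z) :
    ratBits x ≤ 1 + Nat.size z.natAbs + Nat.size d.natAbs := by
  have hd' : (d : ℚ) ≠ 0 := by exact_mod_cast hd
  have hx : x = Rat.divInt z d := by rw [Rat.divInt_eq_div, eq_div_iff hd', h]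
  have h1 : x.den ∣ d.natAbs := by
    have := Rat.den_dvd z d
    rw [← hx] at this
    exact Int.natCast_dvd.1 this
  have hden : Nat.size x.den ≤ Nat.size d.natAbs :=
    Nat.size_le_size (Nat.le_of_dvd (Int.natAbs_pos.2 hd) h1)
  have hnum : Nat.size x.num.natAbs ≤ Nat.size z.natAbs := by
    by_cases hz : z = 0
    · have : x = 0 := by simpa [hz, hd'] using h
      simp [this]
    · refine Nat.size_le_size (Nat.le_of_dvd (Int.natAbs_pos.2 hz) ?_)
      have := Rat.num_dvd z hd
      rw [← hx] at this
      exact Int.natAbs_dvd_natAbs.2 this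
  unfold ratBits
  omega

theorem ratBits_mul_le (x y : ℚ) : ratBits (x * y) ≤ ratBits x + ratBits y := by
  have h : x * y * ((x.den * y.den : ℤ) : ℚ) = ((x.num * y.num : ℤ) : ℚ) := by
    push_cast
    rw [← Rat.mul_den_eq_num x, ← Rat.mul_den_eq_num y]
    ring
  have := ratBits_le_of_mul_eq (by have := x.den_nz; have := y.den_nz; positivity) h
  have h1 := Nat.size_mul_le x.num.natAbs y.num.natAbs
  have h2 := Nat.size_mul_le x.den y.den
  rw [Int.natAbs_mul, Int.natAbs_mul, Int.natAbs_natCast, Int.natAbs_natCast] at this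
  unfold ratBits at *
  omega

theorem ratBits_add_le (x y : ℚ) : ratBits (x + y) ≤ 2 * (ratBits x + ratBits y) := by
  have h : (x + y) * ((x.den * y.den : ℤ) : ℚ) = ((x.num * y.den + y.num * x.den : ℤ) : ℚ) := by
    push_cast
    rw [← Rat.mul_den_eq_num x, ← Rat.mul_den_eq_num y]
    ring
  have := ratBits_le_of_mul_eq (by have := x.den_nz; have := y.den_nz; positivity) h
  have h1 := Nat.size_mul_le x.num.natAbs y.den
  have h3 := Nat.size_mul_le y.num.natAbs x.den
  have h2 := Nat.size_mul_le x.den y.den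
  have h4 := Nat.size_add_le (x.num.natAbs * y.den) (y.num.natAbs * x.den)
  have h5 : Nat.size (x.num * y.den + y.num * x.den : ℤ).natAbs ≤
      Nat.size (x.num.natAbs * y.den + y.num.natAbs * x.den) := by
    refine Nat.size_le_size ((Int.natAbs_add_le _ _).trans ?_)
    simp [Int.natAbs_mul]
  have h6 := one_le_size x.den_nz
  have h7 := one_le_size y.den_nz
  rw [Int.natAbs_mul, Int.natAbs_natCast, Int.natAbs_natCast] at this
  unfold ratBits at *
  omega

@[simp] theorem ratBits_neg (x : ℚ) : ratBits (-x) = ratBits x := by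
  simp [ratBits]

@[simp] theorem ratBits_zero : ratBits 0 = 2 := by
  simp [ratBits]

@[simp] theorem ratBits_one : ratBits 1 = 3 := by
  simp [ratBits]

theorem two_le_ratBits (x : ℚ) : 2 ≤ ratBits x := by
  have := one_le_size x.den_nz
  unfold ratBits
  omega

theorem ratBits_sub_le (x y : ℚ) : ratBits (x - y) ≤ 2 * (ratBits x + ratBits y) := by
  simpa [sub_eq_add_neg] using ratBits_add_le x (-y)

theorem ratBits_inv_le (x : ℚ) : ratBits x⁻¹ ≤ ratBits x := by
  by_cases hx : x = 0
  · simp [hx]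
  · have h : x⁻¹ * (x.num : ℚ) = ((x.den : ℤ) : ℚ) := by
      rw [← Rat.mul_den_eq_num x]
      push_cast
      field_simp
    have := ratBits_le_of_mul_eq (Rat.num_ne_zero.2 hx) h
    rw [Int.natAbs_natCast] at this
    unfold ratBits at *
    omega

theorem ratBits_div_le (x y : ℚ) : ratBits (x / y) ≤ ratBits x + ratBits y := by
  rw [div_eq_mul_inv]
  exact (ratBits_mul_le _ _).trans (Nat.add_le_add_left (ratBits_inv_le y) _)

theorem size_natAbs_le_of_abs_le {z : ℤ} {a : ℕ} (h : |(z : ℚ)| ≤ 2 ^ a) :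
    Nat.size z.natAbs ≤ a + 1 := by
  rw [Nat.size_le]
  have h1 : |z| ≤ 2 ^ a := by exact_mod_cast h
  have : z.natAbs ≤ 2 ^ a := by zify; exact h1
  rw [pow_succ]
  have := Nat.two_pow_pos a
  omega

/-- A rational number with a short common denominator and a small absolute value is short. -/
theorem ratBits_le_of_common_den {x : ℚ} {d z : ℤ} {a c : ℕ} (hd : d ≠ 0) (h : x * d = z)
    (hda : |(d : ℚ)| ≤ 2 ^ a) (hx : |x| ≤ 2 ^ c) : ratBits x ≤ 2 * a + c + 3 := by
  have h1 := ratBits_le_of_mul_eq hd h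
  have h2 := size_natAbs_le_of_abs_le hda
  have h3 : |(z : ℚ)| ≤ 2 ^ (c + a) := by
    rw [← h, abs_mul, pow_add]
    exact mul_le_mul hx hda (abs_nonneg _) (by positivity)
  have h4 := size_natAbs_le_of_abs_le h3
  omega

theorem abs_le_two_pow_ratBits (x : ℚ) : |x| ≤ 2 ^ ratBits x := by
  have h1 : |x| ≤ x.num.natAbs := by
    have hd : (1 : ℚ) ≤ x.den := by exact_mod_cast x.den_pos
    have : |x| * x.den = x.num.natAbs := by
      rw [Nat.cast_natAbs, Int.cast_abs, ← Rat.mul_den_eq_num x, abs_mul, Nat.abs_cast]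
    rw [← this]
    exact le_mul_of_one_le_right (abs_nonneg _) hd
  have h2 : x.num.natAbs ≤ 2 ^ ratBits x := (Nat.lt_size_self _).le.trans
    (Nat.pow_le_pow_right two_pos (by unfold ratBits; omega))
  exact h1.trans (by exact_mod_cast h2)

theorem den_le_two_pow_ratBits (x : ℚ) : x.den ≤ 2 ^ ratBits x :=
  (Nat.lt_size_self _).le.trans (Nat.pow_le_pow_right two_pos (by unfold ratBits; omega))

theorem ratBits_le_matrixBits {n : ℕ} (H : Matrix (Fin n) (Fin n) ℚ) (i j : Fin n) :
    ratBits (H i j) ≤ matrixBits H :=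
  (Finset.single_le_sum (f := fun j => ratBits (H i j)) (fun _ _ => Nat.zero_le _)
    (Finset.mem_univ j)).trans
  (Finset.single_le_sum (f := fun i => ∑ j, ratBits (H i j)) (fun _ _ => Nat.zero_le _)
    (Finset.mem_univ i))

theorem le_matrixBits {n : ℕ} (H : Matrix (Fin n) (Fin n) ℚ) : n ≤ matrixBits H := by
  have h : ∀ i : Fin n, 1 ≤ ∑ j, ratBits (H i j) := fun i =>
    (by have := two_le_ratBits (H i i); omega : 1 ≤ ratBits (H i i)).trans
      (Finset.single_le_sum (f := fun j => ratBits (H i j)) (fun _ _ => Nat.zero_le _)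
        (Finset.mem_univ i))
  have h2 := Finset.sum_le_sum (s := Finset.univ) fun i _ => h i
  rw [Finset.sum_const, Finset.card_univ, Fintype.card_fin, smul_eq_mul, mul_one] at h2
  exact h2

/-- A common denominator of the entries of `H`, of length at most that of `H`. -/
theorem exists_common_den {n : ℕ} (H : Matrix (Fin n) (Fin n) ℚ) :
    ∃ q : ℕ, q ≠ 0 ∧ q ≤ 2 ^ matrixBits H ∧
      ∃ G : Matrix (Fin n) (Fin n) ℤ, (q : ℚ) • H = G.map (Int.cast : ℤ → ℚ) := by
  refine ⟨∏ i, ∏ j, (H i j).den, ?_, ?_, ?_⟩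
  · exact Finset.prod_ne_zero_iff.2 fun i _ => Finset.prod_ne_zero_iff.2 fun j _ => (H i j).den_nz
  · unfold matrixBits
    rw [← Finset.prod_pow_eq_pow_sum]
    refine Finset.prod_le_prod' fun i _ => ?_
    rw [← Finset.prod_pow_eq_pow_sum]
    exact Finset.prod_le_prod' fun j _ => den_le_two_pow_ratBits _
  · have : ∀ i j, ∃ z : ℤ, ((∏ i, ∏ j, (H i j).den : ℕ) : ℚ) * H i j = z := by
      intro i j
      obtain ⟨c, hc⟩ : (H i j).den ∣ ∏ i, ∏ j, (H i j).den :=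
        (Finset.dvd_prod_of_mem (fun j => (H i j).den) (Finset.mem_univ j)).trans
          (Finset.dvd_prod_of_mem (fun i => ∏ j, (H i j).den) (Finset.mem_univ i))
      refine ⟨c * (H i j).num, ?_⟩
      rw [hc]
      push_cast
      rw [← Rat.mul_den_eq_num (H i j)]
      ring
    choose G hG using this
    exact ⟨Matrix.of G, by ext i j; simpa using hG i j⟩

end RatBits

/-! ### Integrality of partially reduced matrices -/

section Integrality

open Matrix

/-- Let `W = X G Xᵀ` with `G` integral, `det X = 1`, and `X` equal to the identity outside the
columns with `p`. If `W` is diagonal on the rows and columns with `p`, then `δ = ∏ W i i` (over `p`)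
is an integer, and `δ * W i j` is an integer for all `i, j` outside `p`. The reason is that `δ` is
the determinant of the block `G₁₁` and that the remaining block of `W` is the Schur complement
`G₂₂ - G₂₁ G₁₁⁻¹ G₁₂`. -/
theorem integral_schur_complement {ι : Type*} [Fintype ι] [DecidableEq ι] (p : ι → Prop)
    [DecidablePred p] (G : Matrix ι ι ℤ) (X W : Matrix ι ι ℚ)
    (hX : ∀ i j, ¬ p j → X i j = (1 : Matrix ι ι ℚ) i j) (hdet : X.det = 1)
    (hW : W = X * G.map (Int.cast : ℤ → ℚ) * Xᵀ)
    (hdiag : ∀ i j, i ≠ j → p i ∨ p j → W i j = 0) :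
    (∃ z : ℤ, ∏ i : {i // p i}, W i i = z) ∧
      ∀ i j, ¬ p i → ¬ p j → ∃ z : ℤ, (∏ i : {i // p i}, W i i) * W i j = z := by
  let np : ι → Prop := fun i => ¬ p i
  let G' := G.map (Int.cast : ℤ → ℚ)
  have hmul : ∀ (A B : Matrix ι ι ℚ) (r s : ι → Prop), (A * B).toBlock r s =
      A.toBlock r p * B.toBlock p s + A.toBlock r np * B.toBlock np s :=
    fun A B r s => toBlock_mul_eq_add r p s A B
  have hX12 : X.toBlock p np = 0 := by
    ext i j
    have hne : (i : ι) ≠ j := fun h => j.2 (h ▸ i.2)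
    simpa [toBlock_apply, one_apply, hne] using hX i j j.2
  have hX22 : X.toBlock np np = 1 := by
    ext i j
    simpa [toBlock_apply, one_apply, Subtype.ext_iff] using hX i j j.2
  have hT21 : Xᵀ.toBlock np p = 0 := by
    change (X.toBlock p np)ᵀ = 0
    rw [hX12, transpose_zero]
  have hT22 : Xᵀ.toBlock np np = 1 := by
    change (X.toBlock np np)ᵀ = 1
    rw [hX22, transpose_one]
  have hT11 : Xᵀ.toBlock p p = (X.toBlock p p)ᵀ := rfl
  have hT12 : Xᵀ.toBlock p np = (X.toBlock np p)ᵀ := rfl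
  have hd11 : (X.toBlock p p).det = 1 := by
    have h := twoBlockTriangular_det' X p (fun i hi j hj => by
      simpa [toBlock_apply] using congrFun (congrFun hX12 ⟨i, hi⟩) ⟨j, hj⟩)
    have h2 : (toSquareBlockProp X fun i => ¬ p i) = 1 := hX22
    rw [hdet, h2, det_one, mul_one] at h
    exact h.symm
  have hW11 : W.toBlock p p = X.toBlock p p * G'.toBlock p p * (X.toBlock p p)ᵀ := by
    rw [hW, hmul, hmul, hX12, hT21, hT11]
    simp [G']
  have hW21 : (X.toBlock np p * G'.toBlock p p + G'.toBlock np p) * (X.toBlock p p)ᵀ = 0 := by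
    have h0 : W.toBlock np p = 0 := by
      ext i j
      exact hdiag i j (fun h => i.2 (h ▸ j.2)) (Or.inr j.2)
    rw [← h0, hW, hmul, hmul, hX22, hT21, hT11]
    simp [G']
  -- The lower left block of `X` solves this linear system, so Cramer's rule applies to it.
  have h21 : X.toBlock np p * G'.toBlock p p + G'.toBlock np p = 0 := by
    have hu : IsUnit (X.toBlock p p)ᵀ.det := by rw [det_transpose, hd11]; exact isUnit_one
    have := congrArg (· * ((X.toBlock p p)ᵀ)⁻¹) hW21
    simpa [Matrix.mul_assoc, mul_nonsing_inv _ hu] using this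
  have hW22 : W.toBlock np np = X.toBlock np p * G'.toBlock p np + G'.toBlock np np := by
    rw [hW, hmul, hmul, hmul, hX22, hT22, hT12]
    simp only [Matrix.one_mul, Matrix.mul_one]
    rw [show (G.map (Int.cast : ℤ → ℚ)) = G' from rfl, h21]
    simp
  have hδ : ∏ i : {i // p i}, W i i = (G'.toBlock p p).det := by
    have h1 : W.toBlock p p = diagonal fun i : {i // p i} => W i i := by
      ext i j
      by_cases h : i = j
      · simp [h]
      · rw [diagonal_apply_ne _ h]
        exact hdiag i j (fun h' => h (Subtype.ext h')) (Or.inl i.2)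
    rw [← det_diagonal, ← h1, hW11, det_mul, det_mul, det_transpose, hd11]
    ring
  have hcast : ∀ r s : ι → Prop, G'.toBlock r s = (G.toBlock r s).map (Int.castRingHom ℚ) :=
    fun _ _ => rfl
  have hδ' : ∏ i : {i // p i}, W i i = ((G.toBlock p p).det : ℤ) := by
    rw [hδ, hcast]
    exact ((Int.castRingHom ℚ).map_det (G.toBlock p p)).symm
  refine ⟨⟨_, hδ'⟩, fun i j hi hj => ?_⟩
  have key : (∏ i : {i // p i}, W i i) • W.toBlock np np =
      (-(G.toBlock np p * (G.toBlock p p).adjugate * G.toBlock p np) +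
        (G.toBlock p p).det • G.toBlock np np).map (Int.castRingHom ℚ) := by
    have h2 : (∏ i : {i // p i}, W i i) • X.toBlock np p =
        -(G'.toBlock np p * (G'.toBlock p p).adjugate) := by
      have h3 := congrArg (· * (G'.toBlock p p).adjugate) (eq_neg_of_add_eq_zero_left h21)
      simp only [Matrix.mul_assoc, mul_adjugate, Matrix.neg_mul] at h3
      rw [← h3, hδ]
      simp
    rw [hW22, smul_add, ← Matrix.smul_mul, h2, hδ']
    ext a b
    simp only [hcast]
    have hadj : ((G.toBlock p p).map (Int.castRingHom ℚ)).adjugate =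
        ((G.toBlock p p).adjugate).map (Int.castRingHom ℚ) :=
      ((Int.castRingHom ℚ).map_adjugate (G.toBlock p p)).symm
    rw [hadj, ← Matrix.map_mul, Matrix.neg_mul, ← Matrix.map_mul]
    simp [-zsmul_eq_mul]
  have := congrFun (congrFun key ⟨i, hi⟩) ⟨j, hj⟩
  exact ⟨_, this⟩

end Integrality

/-! ### A program logic with time and space bounds -/

namespace RatRAM

@[simp] theorem State.updateIdx_idx (σ : State) (i v j : ℕ) :
    (σ.updateIdx i v).idx j = if j = i then v else σ.idx j := by
  simp [State.updateIdx, Finsupp.update_apply]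

@[simp] theorem State.updateIdx_mem (σ : State) (i v : ℕ) : (σ.updateIdx i v).mem = σ.mem := rfl

@[simp] theorem State.updateRat_idx (σ : State) (a : Ref) (v : ℚ) :
    (σ.updateRat a v).idx = σ.idx := rfl

@[simp] theorem State.updateRat_mem (σ : State) (a : Ref) (v : ℚ) (x : ℕ × ℕ × ℕ) :
    (σ.updateRat a v).mem x = if x = σ.addr a then v else σ.mem x := by
  simp [State.updateRat, Finsupp.update_apply]

/-- A state that fits into nine index registers with values at most `n + 1` and into nine
arrays with coordinates at most `n + 1`, whose cells have encoding length at most `b`. -/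
structure Good (n b : ℕ) (σ : State) : Prop where
  idx_lt : ∀ i, σ.idx i ≠ 0 → i < 9
  idx_le : ∀ i, σ.idx i ≤ n + 1
  mem_lt : ∀ a, σ.mem a ≠ 0 → a.1 < 9 ∧ a.2.1 < n + 2 ∧ a.2.2 < n + 2
  mem_le : ∀ a, ratBits (σ.mem a) ≤ b

/-- A bound for the encoding length of a `Good` state: the contribution of the registers, and the
number of cells times the length of a cell with its address. -/
def spaceBound (n b : ℕ) : ℕ :=
  9 * (9 + (n + 1)) + 9 * ((n + 2) * (n + 2)) * (9 + (n + 2) + (n + 2) + b)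

theorem Good.bits_le {n b : ℕ} {σ : State} (h : Good n b σ) : σ.bits ≤ spaceBound n b := by
  unfold State.bits spaceBound
  refine Nat.add_le_add ?_ ?_
  · have hs : σ.idx.support ⊆ Finset.range 9 := fun i hi =>
      Finset.mem_range.2 (h.idx_lt i (Finsupp.mem_support_iff.1 hi))
    refine (Finset.sum_le_sum_of_subset hs).trans ?_
    refine (Finset.sum_le_card_nsmul _ _ (9 + (n + 1)) fun i hi => ?_).trans (by simp)
    have h1 := Nat.size_le_self i
    have h2 := Nat.size_le_self (σ.idx i)
    have h3 := h.idx_le i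
    have h4 := Finset.mem_range.1 hi
    omega
  · have hs : σ.mem.support ⊆
        Finset.range 9 ×ˢ (Finset.range (n + 2) ×ˢ Finset.range (n + 2)) := fun a ha => by
      have := h.mem_lt a (Finsupp.mem_support_iff.1 ha)
      simpa [Finset.mem_product] using this
    refine (Finset.sum_le_sum_of_subset hs).trans ?_
    refine (Finset.sum_le_card_nsmul _ _ (9 + (n + 2) + (n + 2) + b) fun a ha => ?_).trans
      (by simp)
    simp only [Finset.mem_product, Finset.mem_range] at ha
    have h1 := Nat.size_le_self a.1
    have h2 := Nat.size_le_self a.2.1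
    have h3 := Nat.size_le_self a.2.2
    have h4 := h.mem_le a
    omega

theorem Good.updateIdx {n b : ℕ} {σ : State} (h : Good n b σ) {i v : ℕ} (hi : i < 9)
    (hv : v ≤ n + 1) : Good n b (σ.updateIdx i v) where
  idx_lt j hj := by
    rw [State.updateIdx_idx] at hj
    split_ifs at hj with h1
    · omega
    · exact h.idx_lt j hj
  idx_le j := by
    rw [State.updateIdx_idx]
    split_ifs
    · exact hv
    · exact h.idx_le j
  mem_lt := h.mem_lt
  mem_le := h.mem_le

theorem Good.updateRat {n b : ℕ} {σ : State} (h : Good n b σ) {a : Ref} {v : ℚ}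
    (ha : a.array < 9) (hv : ratBits v ≤ b) : Good n b (σ.updateRat a v) where
  idx_lt := h.idx_lt
  idx_le := h.idx_le
  mem_lt x hx := by
    rw [State.updateRat_mem] at hx
    split_ifs at hx with h1
    · subst h1
      exact ⟨ha, Nat.lt_succ_of_le (h.idx_le _), Nat.lt_succ_of_le (h.idx_le _)⟩
    · exact h.mem_lt x hx
  mem_le x := by
    rw [State.updateRat_mem]
    split_ifs
    · exact hv
    · exact h.mem_le x

/-- Total correctness with resource bounds: from `σ`, if it is `Good`, the program `P` halts within
`t` steps in a `Good` state with `Q`, and never leaves the space of the `Good` states. -/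
def WP (n b : ℕ) (P : Program) (t : ℕ) (Q : State → Prop) (σ : State) : Prop :=
  Good n b σ → ∃ τ t' s, Exec P σ t' s τ ∧ t' ≤ t ∧ s ≤ spaceBound n b ∧ Good n b τ ∧ Q τ

variable {n b : ℕ}

theorem WP.mono {P : Program} {t t' : ℕ} {Q Q' : State → Prop} {σ : State}
    (h : WP n b P t Q σ) (ht : t ≤ t') (hQ : ∀ τ, Q τ → Q' τ) : WP n b P t' Q' σ := by
  intro hσ
  obtain ⟨τ, t₁, s, h1, h2, h3, h4, h5⟩ := h hσ
  exact ⟨τ, t₁, s, h1, h2.trans ht, h3, h4, hQ τ h5⟩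

theorem WP.mono_time {P : Program} {t t' : ℕ} {Q : State → Prop} {σ : State}
    (h : WP n b P t Q σ) (ht : t ≤ t') : WP n b P t' Q σ := h.mono ht fun _ => id

theorem wp_skip {Q : State → Prop} {σ : State} (hQ : Q σ) : WP n b .skip 1 Q σ :=
  fun hσ => ⟨σ, 1, _, .skip σ, le_rfl, hσ.bits_le, hσ, hQ⟩

theorem wp_setIdx {i : ℕ} {e : IdxExpr} {Q : State → Prop} {σ : State} (hi : i < 9)
    (he : e.eval σ ≤ n + 1) (hQ : Q (σ.updateIdx i (e.eval σ))) :
    WP n b (.setIdx i e) 1 Q σ := fun hσ =>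
  have h := hσ.updateIdx hi he
  ⟨_, 1, _, .setIdx σ i e, le_rfl, max_le hσ.bits_le h.bits_le, h, hQ⟩

theorem wp_setRat {a : Ref} {e : RatExpr} {v : ℚ} {Q : State → Prop} {σ : State}
    (ha : a.array < 9) (he : e.eval σ = some v) (hv : ratBits v ≤ b)
    (hQ : Q (σ.updateRat a v)) : WP n b (.setRat a e) 1 Q σ := fun hσ =>
  have h := hσ.updateRat ha hv
  ⟨_, 1, _, .setRat σ a e v he, le_rfl, max_le hσ.bits_le h.bits_le, h, hQ⟩

theorem wp_seq {P P' : Program} {t t' : ℕ} {Q : State → Prop} {σ : State}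
    (h : WP n b P t (WP n b P' t' Q) σ) : WP n b (.seq P P') (t + t') Q σ := by
  intro hσ
  obtain ⟨τ, t₁, s₁, h1, h2, h3, h4, h5⟩ := h hσ
  obtain ⟨υ, t₂, s₂, k1, k2, k3, k4, k5⟩ := h5 h4
  exact ⟨υ, _, _, .seq _ _ _ _ _ _ _ _ _ h1 k1, Nat.add_le_add h2 k2, max_le h3 k3, k4, k5⟩

theorem wp_ite {T : Test} {P P' : Program} {t : ℕ} {Q : State → Prop} {σ : State}
    (h : T.Holds σ → WP n b P t Q σ) (h' : ¬ T.Holds σ → WP n b P' t Q σ) :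
    WP n b (.ite T P P') (t + 1) Q σ := by
  intro hσ
  by_cases hT : T.Holds σ
  · obtain ⟨τ, t₁, s₁, h1, h2, h3, h4, h5⟩ := h hT hσ
    exact ⟨τ, _, _, .iteTrue _ _ _ _ _ _ _ hT h1, by omega, h3, h4, h5⟩
  · obtain ⟨τ, t₁, s₁, h1, h2, h3, h4, h5⟩ := h' hT hσ
    exact ⟨τ, _, _, .iteFalse _ _ _ _ _ _ _ hT h1, by omega, h3, h4, h5⟩

/-- The rule for loops, with an invariant `I` and a decreasing measure `μ`. -/
theorem wp_loop {T : Test} {P : Program} {t : ℕ} (I : State → Prop) (μ : State → ℕ)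
    (hbody : ∀ σ, I σ → T.Holds σ → WP n b P t (fun τ => I τ ∧ μ τ < μ σ) σ)
    {σ : State} (hI : I σ) :
    WP n b (.loop T P) (μ σ * (t + 1) + 1) (fun τ => I τ ∧ ¬ T.Holds τ) σ := by
  induction h : μ σ using Nat.strong_induction_on generalizing σ with
  | _ m ih =>
    intro hσ
    by_cases hT : T.Holds σ
    · obtain ⟨τ, t₁, s₁, h1, h2, h3, h4, h5, h6⟩ := hbody σ hI hT hσ
      obtain ⟨υ, t₂, s₂, k1, k2, k3, k4, k5⟩ := ih (μ τ) (h ▸ h6) h5 rfl h4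
      refine ⟨υ, _, _, .loopTrue _ _ _ _ _ _ _ _ _ hT h1 k1, ?_, max_le h3 k3, k4, k5⟩
      have h7 : (μ τ + 1) * (t + 1) ≤ m * (t + 1) := Nat.mul_le_mul_right _ (by omega)
      have h8 : (μ τ + 1) * (t + 1) = μ τ * (t + 1) + (t + 1) := by ring
      omega
    · exact ⟨σ, 1, _, .loopFalse _ _ _ hT, by omega, hσ.bits_le, hσ, hI, hT⟩

/-- `for r := m₀, …, n - 1 do P`, where register `r` holds `m₀` at the start. The loop condition is
tested against register `0` and the increment is in register `6`:
these registers hold `n` and `1`. -/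
def Program.forUp (r : ℕ) (P : Program) : Program :=
  .loop (.idxLt r 0) (.seq P (.setIdx r (.add r 6)))

/-- The rule for `forUp`, with an invariant that depends on the value of the counter; the body
must not change the counter. -/
theorem wp_forUp {r : ℕ} {P : Program} {t m₀ : ℕ} (I : ℕ → State → Prop) (hr : r < 9)
    (hI : ∀ m σ, I m σ → σ.idx r = m ∧ σ.idx 0 = n)
    (hbody : ∀ m σ, m < n → I m σ → WP n b P t
      (fun τ => τ.idx r = m ∧ τ.idx 6 = 1 ∧ I (m + 1) (τ.updateIdx r (m + 1))) σ)
    (hm : m₀ ≤ n) {σ : State} (h : I m₀ σ) :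
    WP n b (.forUp r P) (n * (t + 2) + 1) (I n) σ := by
  have key := wp_loop (n := n) (b := b) (T := .idxLt r 0)
    (P := .seq P (.setIdx r (.add r 6))) (t := t + 1)
    (fun σ => ∃ m ≤ n, I m σ) (fun σ => n - σ.idx r) ?_ (σ := σ) ⟨m₀, hm, h⟩
  · refine key.mono ?_ ?_
    · have : (n - σ.idx r) * (t + 1 + 1) ≤ n * (t + 2) :=
        Nat.mul_le_mul_right _ (Nat.sub_le _ _)
      omega
    · rintro τ ⟨⟨m, hm, hIm⟩, hT⟩
      have h1 := hI m τ hIm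
      simp only [Test.Holds, h1] at hT
      obtain rfl : m = n := by omega
      exact hIm
  · rintro τ ⟨m, hm, hIm⟩ hT
    have h1 := hI m τ hIm
    simp only [Test.Holds, h1] at hT
    refine wp_seq ((hbody m τ hT hIm).mono le_rfl ?_)
    rintro υ ⟨h2, h3, h4⟩
    have h5 : IdxExpr.eval υ (.add r 6) = m + 1 := by simp [IdxExpr.eval, h2, h3]
    refine wp_setIdx hr (by omega) ?_
    rw [h5]
    refine ⟨⟨m + 1, hT, h4⟩, ?_⟩
    simp only [State.updateIdx_idx, if_true, h1]
    omega

end RatRAM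

/-! ### Elementary congruence operations on the machine -/

namespace RatRAM

open Matrix

variable {n b : ℕ}

/-- `dst += x * src` along a line of cells, where register `5` runs through `0, …, n - 1` and the
factor `x` is in the cell `(x, 0, 0)`; the cell `(3, 0, 0)` is scratch. Register `8` holds `0`. -/
def Program.axpy (dst src : Ref) (x : ℕ) : Program :=
  .seq (.setIdx 5 (.const 0)) (.forUp 5
    (.seq (.setRat ⟨3, 8, 8⟩ (.mul ⟨x, 8, 8⟩ src)) (.setRat dst (.add dst ⟨3, 8, 8⟩))))

/-- `da m` and `sa m` are the addresses of the cells that `dst` and `src` denote when register `5`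
holds `m`. -/
theorem wp_axpy {dst src : Ref} {x : ℕ} {da sa : ℕ → ℕ × ℕ × ℕ} {Q : State → Prop} {σ : State}
    (h0 : σ.idx 0 = n) (h6 : σ.idx 6 = 1) (h8 : σ.idx 8 = 0) (hx : 3 < x)
    (hda : ∀ τ : State, (∀ r, r ≠ 5 → τ.idx r = σ.idx r) → τ.addr dst = da (τ.idx 5))
    (hsa : ∀ τ : State, (∀ r, r ≠ 5 → τ.idx r = σ.idx r) → τ.addr src = sa (τ.idx 5))
    (hda3 : ∀ m, (da m).1 < 3) (hsa3 : ∀ m, (sa m).1 < 3)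
    (hinj : ∀ m m', da m = da m' → m = m') (hdisj : ∀ m m', sa m ≠ da m')
    (hb1 : ∀ m < n, ratBits (σ.mem (x, 0, 0) * σ.mem (sa m)) ≤ b)
    (hb2 : ∀ m < n, ratBits (σ.mem (da m) + σ.mem (x, 0, 0) * σ.mem (sa m)) ≤ b)
    (hQ : ∀ τ : State, (∀ r, r ≠ 5 → τ.idx r = σ.idx r) →
      (∀ m < n, τ.mem (da m) = σ.mem (da m) + σ.mem (x, 0, 0) * σ.mem (sa m)) →
      (∀ a, a.1 ≠ 3 → (∀ m < n, a ≠ da m) → τ.mem a = σ.mem a) → Q τ) :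
    WP n b (.axpy dst src x) (4 * n + 2) Q σ := by
  have hd9 : dst.array < 9 := by
    have h1 := hda3 (σ.idx 5)
    rw [← hda σ fun _ _ => rfl] at h1
    exact Nat.lt_trans h1 (by norm_num)
  have hx3 : ∀ m, (x, 0, 0) ≠ da m := fun m h => by
    have := hda3 m
    rw [← h] at this
    omega
  refine (wp_seq (t := 1) (t' := n * (2 + 2) + 1) (wp_setIdx (by norm_num) (Nat.zero_le _)
    ((wp_forUp (m₀ := 0) (fun m τ => (∀ r, r ≠ 5 → τ.idx r = σ.idx r) ∧ τ.idx 5 = m ∧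
      (∀ l < m, τ.mem (da l) = σ.mem (da l) + σ.mem (x, 0, 0) * σ.mem (sa l)) ∧
      (∀ a, a.1 ≠ 3 → (∀ l < m, a ≠ da l) → τ.mem a = σ.mem a)) (by norm_num) ?_ ?_ (Nat.zero_le _)
      ?_).mono le_rfl ?_))).mono_time (by omega)
  · rintro m τ ⟨h1, h2, -⟩
    exact ⟨h2, (h1 0 (by norm_num)).trans h0⟩
  · rintro m τ hm ⟨h1, h2, h3, h4⟩
    have e3 : τ.addr ⟨3, 8, 8⟩ = (3, 0, 0) := by simp [State.addr, h1, h8]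
    have ex : τ.addr ⟨x, 8, 8⟩ = (x, 0, 0) := by simp [State.addr, h1, h8]
    have es : τ.addr src = sa m := by rw [hsa τ h1, h2]
    have ed : τ.addr dst = da m := by rw [hda τ h1, h2]
    have vx : τ.mem (x, 0, 0) = σ.mem (x, 0, 0) := h4 _ (by simpa using by omega) fun l _ => hx3 l
    have vs : τ.mem (sa m) = σ.mem (sa m) :=
      h4 _ (by have := hsa3 m; omega) fun l _ => hdisj m l
    have vd : τ.mem (da m) = σ.mem (da m) :=
      h4 _ (by have := hda3 m; omega) fun l hl h => by have := hinj _ _ h; omega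
    have d3 : da m ≠ (3, 0, 0) := fun h => by have := hda3 m; rw [h] at this; simp at this
    refine wp_seq (t := 1) (t' := 1) (wp_setRat (v := σ.mem (x, 0, 0) * σ.mem (sa m))
      (by norm_num) (by simp [RatExpr.eval, State.get, ex, es, vx, vs]) (hb1 m hm) ?_)
    have ed' : ∀ v, (τ.updateRat ⟨3, 8, 8⟩ v).addr dst = da m := fun v => ed
    have e3' : ∀ v, (τ.updateRat ⟨3, 8, 8⟩ v).addr ⟨3, 8, 8⟩ = (3, 0, 0) := fun v => e3
    refine wp_setRat (v := σ.mem (da m) + σ.mem (x, 0, 0) * σ.mem (sa m)) hd9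
      (by simp [RatExpr.eval, State.get, ed', e3', e3, d3, vd]) (hb2 m hm) ⟨?_, ?_, ?_, ?_, ?_, ?_⟩
    · simpa using h2
    · simpa [h6] using h1 6 (by norm_num)
    · intro r hr
      simp [hr, h1 r hr]
    · simp
    · intro l hl
      simp only [State.updateIdx_mem, State.updateRat_mem, ed', e3]
      rcases Nat.lt_succ_iff_lt_or_eq.1 hl with h | rfl
      · have h5 : da l ≠ da m := fun h' => by have := hinj _ _ h'; omega
        have h6 : da l ≠ (3, 0, 0) := fun h => by have := hda3 l; rw [h] at this; simp at this
        rw [if_neg h5, if_neg h6, h3 l h]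
      · simp
    · intro a ha hal
      have h5 : a ≠ (3, 0, 0) := fun h => ha (by rw [h])
      simp only [State.updateIdx_mem, State.updateRat_mem, ed', e3]
      rw [if_neg (hal m (by omega)), if_neg h5]
      exact h4 a ha fun l hl => hal l (by omega)
  · exact ⟨fun r hr => by simp [hr], by simp [IdxExpr.eval], fun l hl => by omega,
      fun a _ _ => rfl⟩
  · rintro τ ⟨h1, h2, h3, h4⟩
    exact hQ τ h1 h3 h4

theorem transvection_congruence_apply {ι : Type*} [Fintype ι] [DecidableEq ι] (p q : ι) (c : ℚ)
    (W : Matrix ι ι ℚ) (i j : ι) :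
    (transvection p q c * W * (transvection p q c)ᵀ) i j =
      (W i j + if i = p then c * W q j else 0) +
        if j = p then c * (W i q + if i = p then c * W q q else 0) else 0 := by
  have h1 : ∀ i j, (transvection p q c * W) i j = W i j + if i = p then c * W q j else 0 := by
    intro i j
    split_ifs with h
    · subst h; simp
    · simp [h]
  have h2 : (transvection p q c)ᵀ = transvection q p c := by
    simp [transvection, transpose_single]
  rw [h2]
  split_ifs with hj hi hi
  · subst hj; subst hi; simp [h1]
  · subst hj; simp [h1, hi]
  · subst hi; simp [h1, hj]
  · simp [h1, hi, hj]

theorem mul_transvection_apply {ι : Type*} [Fintype ι] [DecidableEq ι] (p q : ι) (c : ℚ)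
    (L : Matrix ι ι ℚ) (i j : ι) :
    (L * transvection p q c) i j = L i j + if j = q then c * L i p else 0 := by
  split_ifs with h
  · subst h; simp
  · simp [h]

theorem transvection_mul_apply {ι : Type*} [Fintype ι] [DecidableEq ι] (p q : ι) (c : ℚ)
    (M : Matrix ι ι ℚ) (i j : ι) :
    (transvection p q c * M) i j = M i j + if i = p then c * M q j else 0 := by
  split_ifs with h
  · subst h; simp
  · simp [h]

/-- The congruence `W ↦ T W Tᵀ` of array `0` and the update `L ↦ L T⁻¹` of array `1`, for the
transvection `T = 1 + c e_p e_qᵀ`, where the registers `rp` and `rq` hold `p` and `q` and the cell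
`(4, 0, 0)` holds `c`. -/
def Program.congruence (rp rq : ℕ) : Program :=
  .seq (.setRat ⟨5, 8, 8⟩ (.sub ⟨7, 8, 8⟩ ⟨4, 8, 8⟩)) (.seq (.axpy ⟨0, rp, 5⟩ ⟨0, rq, 5⟩ 4)
    (.seq (.axpy ⟨0, 5, rp⟩ ⟨0, 5, rq⟩ 4) (.axpy ⟨1, 5, rq⟩ ⟨1, 5, rp⟩ 5)))

/-- Constant registers and cells: register `0` holds `n`, register `6` holds `1`, register `7`
holds `n - 1` (which is `0` for `n = 0`), register `8` holds `0`, the cell `(7, 0, 0)` holds `0`,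
and array `2` is empty. -/
structure Frame (n : ℕ) (σ : State) : Prop where
  h0 : σ.idx 0 = n
  h6 : σ.idx 6 = 1
  h7 : σ.idx 7 = n - 1
  h8 : σ.idx 8 = 0
  hz : σ.mem (7, 0, 0) = 0
  hD : ∀ a, a.1 = 2 → σ.mem a = 0

/-- If the entries have length at most `b₁`, then they have length at most `6 * b₁` after the row
operation and at most `26 * b₁` after the column operation. -/
theorem wp_congruence {rp rq : ℕ} {p q : Fin n} {b₁ : ℕ} {Q : State → Prop} {σ : State}
    (hF : Frame n σ) (hrp : rp ≠ 5) (hrq : rq ≠ 5) (hp : σ.idx rp = p) (hq : σ.idx rq = q)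
    (hpq : p ≠ q) (hb : 26 * b₁ ≤ b) (hc : ratBits (σ.mem (4, 0, 0)) ≤ b₁)
    (hW : ∀ i j, ratBits (σ.matrix n 0 i j) ≤ b₁) (hL : ∀ i j, ratBits (σ.matrix n 1 i j) ≤ b₁)
    (hQ : ∀ τ : State, (∀ r, r ≠ 5 → τ.idx r = σ.idx r) →
      (∀ a, a.1 ≠ 0 → a.1 ≠ 1 → a.1 ≠ 3 → a.1 ≠ 5 → τ.mem a = σ.mem a) →
      τ.matrix n 0 = transvection p q (σ.mem (4, 0, 0)) * σ.matrix n 0 *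
        (transvection p q (σ.mem (4, 0, 0)))ᵀ →
      τ.matrix n 1 = σ.matrix n 1 * transvection p q (-σ.mem (4, 0, 0)) → Q τ) :
    WP n b (.congruence rp rq) (12 * n + 7) Q σ := by
  have hpq' : (p : ℕ) ≠ q := fun h => hpq (Fin.ext h)
  set c := σ.mem (4, 0, 0) with hcdef
  refine (wp_seq (t := 1) (t' := (4 * n + 2) + ((4 * n + 2) + (4 * n + 2)))
    (wp_setRat (v := -c) (by norm_num)
    (by simp [RatExpr.eval, State.get, State.addr, hF.h8, hF.hz, hcdef]) (by simpa using by omega)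
    ?_)).mono_time (by omega)
  have e5 : σ.addr ⟨5, 8, 8⟩ = (5, 0, 0) := by simp [State.addr, hF.h8]
  set σ₁ := σ.updateRat ⟨5, 8, 8⟩ (-c) with hσ₁
  have m1 : ∀ a, σ₁.mem a = if a = (5, 0, 0) then -c else σ.mem a := fun a => by
    rw [hσ₁, State.updateRat_mem, e5]
  have i1 : σ₁.idx = σ.idx := rfl
  have bW : ∀ i j : ℕ, i < n → j < n → ratBits (σ.mem (0, i, j)) ≤ b₁ :=
    fun i j hi hj => hW ⟨i, hi⟩ ⟨j, hj⟩
  have bL : ∀ i j : ℕ, i < n → j < n → ratBits (σ.mem (1, i, j)) ≤ b₁ :=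
    fun i j hi hj => hL ⟨i, hi⟩ ⟨j, hj⟩
  refine wp_seq (wp_axpy (da := fun m => (0, p, m)) (sa := fun m => (0, q, m)) hF.h0 hF.h6 hF.h8
    (by norm_num)
    (fun τ h => by simp [State.addr, h rp hrp, i1, hp])
    (fun τ h => by simp [State.addr, h rq hrq, i1, hq]) (by simp) (by simp) (by simp)
    (by simp [Ne.symm hpq']) ?_ ?_ ?_)
  · intro m hm
    simp only [m1]
    have h1 := bW q m q.2 hm
    have h2 := ratBits_mul_le c (σ.mem (0, q, m))
    simpa [← hcdef] using by omega
  · intro m hm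
    simp only [m1]
    have h1 := bW q m q.2 hm
    have h2 := ratBits_mul_le c (σ.mem (0, q, m))
    have h3 := bW p m p.2 hm
    have h4 := ratBits_add_le (σ.mem (0, p, m)) (c * σ.mem (0, q, m))
    simpa [← hcdef] using by omega
  intro σ₂ i2 d2 m2
  have w2 : ∀ i j : Fin n, σ₂.mem (0, i, j) =
      σ.matrix n 0 i j + if i = p then c * σ.matrix n 0 q j else 0 := by
    intro i j
    split_ifs with h
    · subst h
      simpa [m1, State.matrix, ← hcdef] using d2 j j.2
    · have h' : (i : ℕ) ≠ p := fun h' => h (Fin.ext h')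
      rw [m2 _ (by simp) (by simp [h']), m1]
      simp [State.matrix]
  have bW2 : ∀ i j : Fin n, ratBits (σ₂.mem (0, i, j)) ≤ 6 * b₁ := by
    intro i j
    rw [w2]
    have h1 := hW i j
    split_ifs
    · have h2 := hW q j
      have h3 := ratBits_mul_le c (σ.matrix n 0 q j)
      have h4 := ratBits_add_le (σ.matrix n 0 i j) (c * σ.matrix n 0 q j)
      omega
    · rw [add_zero]; omega
  have c2 : σ₂.mem (4, 0, 0) = c := by
    rw [m2 _ (by simp) (by simp), m1]
    simp [hcdef]
  refine wp_seq (wp_axpy (da := fun m => (0, m, p)) (sa := fun m => (0, m, q))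
    ((i2 0 (by norm_num)).trans hF.h0) ((i2 6 (by norm_num)).trans hF.h6)
    ((i2 8 (by norm_num)).trans hF.h8) (by norm_num)
    (fun τ h => by simp [State.addr, h rp hrp, i2 rp hrp, i1, hp])
    (fun τ h => by simp [State.addr, h rq hrq, i2 rq hrq, i1, hq]) (by simp) (by simp)
    (fun m m' h => by simpa using h) (by simp [Ne.symm hpq']) ?_ ?_ ?_)
  · intro m hm
    have h1 := bW2 ⟨m, hm⟩ q
    have h2 := ratBits_mul_le c (σ₂.mem (0, m, q))
    simp only at h1
    rw [c2]
    omega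
  · intro m hm
    have h1 := bW2 ⟨m, hm⟩ q
    have h2 := ratBits_mul_le c (σ₂.mem (0, m, q))
    have h3 := bW2 ⟨m, hm⟩ p
    have h4 := ratBits_add_le (σ₂.mem (0, m, p)) (c * σ₂.mem (0, m, q))
    simp only at h1 h3
    rw [c2]
    omega
  intro σ₃ i3 d3 m3
  have w3 : σ₃.matrix n 0 = transvection p q c * σ.matrix n 0 * (transvection p q c)ᵀ := by
    ext i j
    rw [transvection_congruence_apply, State.matrix, of_apply]
    by_cases h : j = p
    · subst h
      rw [d3 i i.2, c2, w2, w2, if_pos rfl]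
    · have h' : (j : ℕ) ≠ p := fun h' => h (Fin.ext h')
      rw [m3 _ (by simp) (by simp [h']), w2, if_neg h, add_zero]
  have c3 : σ₃.mem (5, 0, 0) = -c := by
    rw [m3 _ (by simp) (by simp), m2 _ (by simp) (by simp), m1]
    simp
  have l3 : ∀ i j : ℕ, σ₃.mem (1, i, j) = σ.mem (1, i, j) := fun i j => by
    rw [m3 _ (by simp) (by simp), m2 _ (by simp) (by simp), m1]
    simp
  refine wp_axpy (da := fun m => (1, m, q)) (sa := fun m => (1, m, p))
    ((i3 0 (by norm_num)).trans ((i2 0 (by norm_num)).trans hF.h0))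
    ((i3 6 (by norm_num)).trans ((i2 6 (by norm_num)).trans hF.h6))
    ((i3 8 (by norm_num)).trans ((i2 8 (by norm_num)).trans hF.h8)) (by norm_num)
    (fun τ h => by simp [State.addr, h rq hrq, i3 rq hrq, i2 rq hrq, i1, hq])
    (fun τ h => by simp [State.addr, h rp hrp, i3 rp hrp, i2 rp hrp, i1, hp]) (by simp) (by simp)
    (fun m m' h => by simpa using h) (by simp [hpq']) ?_ ?_ ?_
  · intro m hm
    have h1 := bL m p hm p.2
    have h2 := ratBits_mul_le (-c) (σ.mem (1, m, p))
    rw [c3, l3]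
    rw [ratBits_neg] at h2
    omega
  · intro m hm
    have h1 := bL m p hm p.2
    have h2 := ratBits_mul_le (-c) (σ.mem (1, m, p))
    have h3 := bL m q hm q.2
    have h4 := ratBits_add_le (σ.mem (1, m, q)) (-c * σ.mem (1, m, p))
    rw [c3, l3, l3]
    rw [ratBits_neg] at h2
    omega
  intro σ₄ i4 d4 m4
  refine hQ σ₄ (fun r hr => by rw [i4 r hr, i3 r hr, i2 r hr, i1]) ?_ ?_ ?_
  · intro a a0 a1 a3 a5
    have n1 : ∀ u v : ℕ, a ≠ (1, u, v) := fun u v h => a1 (by rw [h])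
    have n0 : ∀ u v : ℕ, a ≠ (0, u, v) := fun u v h => a0 (by rw [h])
    have n5 : a ≠ (5, 0, 0) := fun h => a5 (by rw [h])
    rw [m4 a a3 (fun m _ => n1 _ _), m3 a a3 (fun m _ => n0 _ _), m2 a a3 (fun m _ => n0 _ _), m1,
      if_neg n5]
  · rw [← w3]
    ext i j
    exact m4 (0, i, j) (by simp) (by simp)
  · ext i j
    rw [mul_transvection_apply, State.matrix, of_apply]
    by_cases h : j = q
    · subst h
      rw [d4 i i.2, c3, l3, l3, if_pos rfl]
      rfl
    · have h' : (j : ℕ) ≠ q := fun h' => h (Fin.ext h')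
      rw [m4 _ (by simp) (by simp [h']), l3, if_neg h, add_zero]
      rfl

end RatRAM

/-! ### The search for a pivot -/

namespace RatRAM

open Matrix

variable {n b : ℕ}

/-- Compare `|W i j|`, for `i` and `j` in the registers `4` and `5`, with the best value so far,
which is in the cell `(6, 0, 0)` and was found at the position in the registers `2` and `3`. -/
def Program.visit : Program :=
  .seq (.setRat ⟨3, 8, 8⟩ (.cell ⟨0, 4, 5⟩))
    (.seq (.ite (.ratLe ⟨3, 8, 8⟩ ⟨7, 8, 8⟩) (.setRat ⟨3, 8, 8⟩ (.sub ⟨7, 8, 8⟩ ⟨3, 8, 8⟩)) .skip)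
      (.ite (.ratLe ⟨3, 8, 8⟩ ⟨6, 8, 8⟩) .skip
        (.seq (.setRat ⟨6, 8, 8⟩ (.cell ⟨3, 8, 8⟩))
          (.seq (.setIdx 2 (.reg 4)) (.setIdx 3 (.reg 5))))))

/-- Find an entry of largest absolute value in the upper triangle of the trailing block that
starts at the row and column in register `1`. The search starts with the value `0` and the first
diagonal position, so the value never exceeds the absolute value of the entry at the position. -/
def Program.search : Program :=
  .seq (.setRat ⟨6, 8, 8⟩ (.cell ⟨7, 8, 8⟩))
    (.seq (.setIdx 2 (.reg 1)) (.seq (.setIdx 3 (.reg 1)) (.seq (.setIdx 4 (.reg 1))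
      (.forUp 4 (.seq (.setIdx 5 (.reg 4)) (.forUp 5 .visit))))))

/-- The state `τ` of a search that started in `σ` and has visited the positions in `S`. -/
structure SearchInv (n : ℕ) (σ : State) (k : ℕ) (S : ℕ → ℕ → Prop) (τ : State) : Prop where
  idx : ∀ r, r ≠ 2 → r ≠ 3 → r ≠ 4 → r ≠ 5 → τ.idx r = σ.idx r
  mem : ∀ a, a.1 ≠ 3 → a.1 ≠ 6 → τ.mem a = σ.mem a
  le_row : k ≤ τ.idx 2
  row_le_col : τ.idx 2 ≤ τ.idx 3
  col_lt : τ.idx 3 < n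
  best_le : τ.mem (6, 0, 0) ≤ |σ.mem (0, τ.idx 2, τ.idx 3)|
  le_best : ∀ i j, S i j → |σ.mem (0, i, j)| ≤ τ.mem (6, 0, 0)

theorem wp_visit {σ τ : State} {k i j : ℕ} {S : ℕ → ℕ → Prop} (hF : Frame n σ)
    (h : SearchInv n σ k S τ) (hi : τ.idx 4 = i) (hj : τ.idx 5 = j) (hki : k ≤ i) (hij : i ≤ j)
    (hjn : j < n) (hb : ratBits (σ.mem (0, i, j)) ≤ b) :
    WP n b .visit 7 (fun υ => υ.idx 4 = i ∧ υ.idx 5 = j ∧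
      SearchInv n σ k (fun i' j' => S i' j' ∨ (i' = i ∧ j' = j)) υ) τ := by
  have e8 : τ.idx 8 = 0 := (h.idx 8 (by norm_num) (by norm_num) (by norm_num) (by norm_num)).trans
    hF.h8
  have vz : τ.mem (7, 0, 0) = 0 := (h.mem _ (by simp) (by simp)).trans hF.hz
  have vw : τ.mem (0, i, j) = σ.mem (0, i, j) := h.mem _ (by simp) (by simp)
  set w := σ.mem (0, i, j) with hw
  refine wp_seq (t := 1) (t' := 2 + 4) (wp_setRat (v := w) (by norm_num)
    (by simp [RatExpr.eval, State.get, State.addr, hi, hj, vw]) hb ?_)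
  refine wp_seq (WP.mono (Q := fun υ => υ = (τ.updateRat ⟨3, 8, 8⟩ w).updateRat ⟨3, 8, 8⟩ |w|)
    (wp_ite (t := 1) (fun hT => ?_) (fun hT => ?_)) le_rfl ?_)
  · have hT' : w ≤ 0 := by simpa [Test.Holds, State.get, State.addr, e8, vz] using hT
    refine wp_setRat (v := -w) (by norm_num)
      (by simp [RatExpr.eval, State.get, State.addr, e8, vz]) (by simpa using hb) ?_
    rw [abs_of_nonpos hT']
  · have hT' : ¬ w ≤ 0 := by simpa [Test.Holds, State.get, State.addr, e8, vz] using hT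
    refine wp_skip ?_
    rw [abs_of_pos (not_le.1 hT')]
    simp [State.updateRat, State.addr]
  rintro υ rfl
  refine wp_ite (t := 3) (fun hT => ?_) (fun hT => ?_)
  · have hT' : |w| ≤ τ.mem (6, 0, 0) := by
      simpa [Test.Holds, State.get, State.addr, e8] using hT
    refine (wp_skip ⟨hi, hj, ?_⟩).mono_time (by norm_num)
    have e3 : ∀ v, (τ.updateRat ⟨3, 8, 8⟩ v).addr ⟨3, 8, 8⟩ = (3, 0, 0) := fun v => by
      simp [State.addr, e8]
    refine ⟨h.idx, ?_, h.le_row, h.row_le_col, h.col_lt, ?_, ?_⟩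
    · intro a a3 a6
      have h3 : a ≠ (3, 0, 0) := fun h => a3 (by rw [h])
      simp [State.addr, e8, h3, h.mem a a3 a6]
    · simpa [State.addr, e8] using h.best_le
    · rintro i' j' (hS | ⟨rfl, rfl⟩)
      · simpa [State.addr, e8] using h.le_best _ _ hS
      · simpa [State.addr, e8] using hT'
  · have hT' : τ.mem (6, 0, 0) < |w| := by
      simpa [Test.Holds, State.get, State.addr, e8] using hT
    have hbw : ratBits |w| ≤ b := by
      rcases abs_choice w with h | h <;> rw [h]
      · exact hb
      · simpa using hb
    refine wp_seq (t := 1) (t' := 1 + 1) (wp_setRat (v := |w|) (by norm_num)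
      (by simp [RatExpr.eval, State.get, State.addr, e8]) hbw ?_)
    refine wp_seq (wp_setIdx (by norm_num) (by simp [IdxExpr.eval, hi]; omega) ?_)
    refine wp_setIdx (by norm_num) (by simp [IdxExpr.eval, hj]; omega) ?_
    simp only [IdxExpr.eval, State.updateIdx_idx, State.updateRat_idx, hi, hj]
    refine ⟨by simp, by simp, ?_⟩
    have e3 : ∀ v, (τ.updateRat ⟨3, 8, 8⟩ v).addr ⟨3, 8, 8⟩ = (3, 0, 0) := fun v => by
      simp [State.addr, e8]
    refine ⟨?_, ?_, ?_, ?_, ?_, ?_, ?_⟩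
    · intro r h2 h3 h4 h5
      simp [h2, h3, h.idx r h2 h3 h4 h5]
    · intro a a3 a6
      have h3 : a ≠ (3, 0, 0) := fun h => a3 (by rw [h])
      have h6 : a ≠ (6, 0, 0) := fun h => a6 (by rw [h])
      simp [State.addr, e8, h3, h6, h.mem a a3 a6]
    · simpa using hki
    · simpa [hj] using hij
    · simpa [hj] using hjn
    · simp [State.addr, e8, hw]
    · rintro i' j' (hS | ⟨rfl, rfl⟩)
      · simpa [State.addr, e8] using (h.le_best _ _ hS).trans hT'.le
      · simp [State.addr, e8, hw]

theorem wp_search {σ : State} {k : ℕ} {Q : State → Prop} (hF : Frame n σ) (hk : σ.idx 1 = k)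
    (hkn : k < n) (hb : ∀ i j, ratBits (σ.matrix n 0 i j) ≤ b) (hb2 : 2 ≤ b)
    (hQ : ∀ τ : State, (∀ r, r ≠ 2 → r ≠ 3 → r ≠ 4 → r ≠ 5 → τ.idx r = σ.idx r) →
      (∀ a, a.1 ≠ 3 → a.1 ≠ 6 → τ.mem a = σ.mem a) →
      (∃ p q : Fin n, τ.idx 2 = p ∧ τ.idx 3 = q ∧ k ≤ p ∧ p ≤ q ∧
        τ.mem (6, 0, 0) ≤ |σ.matrix n 0 p q| ∧
        ∀ i j : Fin n, k ≤ i → i ≤ j → |σ.matrix n 0 i j| ≤ τ.mem (6, 0, 0)) → Q τ) :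
    WP n b .search (n * (9 * n + 4) + 5) Q σ := by
  have hb' : ∀ i j, i < n → j < n → ratBits (σ.mem (0, i, j)) ≤ b :=
    fun i j hi hj => hb ⟨i, hi⟩ ⟨j, hj⟩
  refine (wp_seq (t := 1) (t' := 1 + (1 + (1 + (n * ((1 + (n * (7 + 2) + 1)) + 2) + 1))))
    (wp_setRat (v := 0) (by norm_num)
    (by simp [RatExpr.eval, State.get, State.addr, hF.h8, hF.hz]) (by simpa using hb2)
    ?_)).mono_time (by ring_nf; omega)
  refine wp_seq (wp_setIdx (by norm_num) (by simp [IdxExpr.eval, hk]; omega) ?_)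
  refine wp_seq (wp_setIdx (by norm_num) (by simp [IdxExpr.eval, hk]; omega) ?_)
  refine wp_seq (wp_setIdx (by norm_num) (by simp [IdxExpr.eval, hk]; omega) ?_)
  refine (wp_forUp (m₀ := k) (fun m τ => k ≤ m ∧ τ.idx 4 = m ∧
    SearchInv n σ k (fun i j => k ≤ i ∧ i ≤ j ∧ j < n ∧ i < m) τ) (by norm_num) ?_ ?_ hkn.le
    ?_).mono le_rfl ?_
  · rintro m τ ⟨-, h4, h⟩
    exact ⟨h4, (h.idx 0 (by norm_num) (by norm_num) (by norm_num) (by norm_num)).trans hF.h0⟩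
  · rintro m τ hm ⟨hkm, h4, h⟩
    refine wp_seq (wp_setIdx (by norm_num) (by simp [IdxExpr.eval, h4]; omega) ?_)
    refine (wp_forUp (m₀ := m) (fun l τ => m ≤ l ∧ τ.idx 4 = m ∧ τ.idx 5 = l ∧
      SearchInv n σ k (fun i j => k ≤ i ∧ i ≤ j ∧ j < n ∧ (i < m ∨ (i = m ∧ j < l))) τ)
      (by norm_num) ?_ ?_ hm.le ?_).mono le_rfl ?_
    · rintro l τ ⟨-, -, h5, h⟩
      exact ⟨h5, (h.idx 0 (by norm_num) (by norm_num) (by norm_num) (by norm_num)).trans hF.h0⟩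
    · rintro l τ hl ⟨hml, h4, h5, h⟩
      refine (wp_visit hF h h4 h5 hkm hml hl (hb' m l hm hl)).mono le_rfl ?_
      rintro υ ⟨u4, u5, hu⟩
      refine ⟨u5, (hu.idx 6 (by norm_num) (by norm_num) (by norm_num) (by norm_num)).trans hF.h6,
        by omega, by simpa using u4, by simp, ?_⟩
      refine ⟨fun r h2 h3 h4 h5 => by simpa [h5] using hu.idx r h2 h3 h4 h5, hu.mem,
        by simpa using hu.le_row, by simpa using hu.row_le_col, by simpa using hu.col_lt,
        by simpa using hu.best_le, fun i j hS => hu.le_best i j ?_⟩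
      have : j < l ∨ j = l ∨ l < j := lt_trichotomy j l
      omega
    · refine ⟨le_rfl, by simpa using h4, by simp [IdxExpr.eval, h4], ?_⟩
      refine ⟨fun r h2 h3 h4 h5 => by simpa [h5] using h.idx r h2 h3 h4 h5, h.mem,
        by simpa using h.le_row, by simpa using h.row_le_col, by simpa using h.col_lt,
        by simpa using h.best_le, fun i j hS => h.le_best i j ?_⟩
      omega
    · rintro τ ⟨-, h4, -, h⟩
      refine ⟨h4, (h.idx 6 (by norm_num) (by norm_num) (by norm_num) (by norm_num)).trans hF.h6,
        by omega, by simp, ?_⟩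
      refine ⟨fun r h2 h3 h4 h5 => by simpa [h4] using h.idx r h2 h3 h4 h5, h.mem,
        by simpa using h.le_row, by simpa using h.row_le_col, by simpa using h.col_lt,
        by simpa using h.best_le, fun i j hS => h.le_best i j ?_⟩
      omega
  · refine ⟨le_rfl, by simp [IdxExpr.eval, hk], ?_⟩
    refine ⟨?_, ?_, ?_, ?_, ?_, ?_, ?_⟩
    · intro r h2 h3 h4 h5
      simp [h2, h3, h4]
    · intro a a3 a6
      have h6 : a ≠ (6, 0, 0) := fun h => a6 (by rw [h])
      simp [State.addr, hF.h8, h6]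
    · simp [IdxExpr.eval, hk]
    · simp [IdxExpr.eval, hk]
    · simpa [IdxExpr.eval, hk] using hkn
    · simp [State.addr, hF.h8]
    · rintro i j ⟨h1, -, -, h2⟩
      omega
  · rintro τ ⟨-, -, h⟩
    refine hQ τ h.idx h.mem ⟨⟨τ.idx 2, h.row_le_col.trans_lt h.col_lt⟩, ⟨τ.idx 3, h.col_lt⟩, rfl,
      rfl, h.le_row, h.row_le_col, h.best_le, fun i j hi hij => h.le_best i j ⟨hi, hij, j.2, i.2⟩⟩

end RatRAM

/-! ### Partially reduced matrices -/

namespace RatRAM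

open Matrix

variable {n : ℕ}

/-- `W = M H Mᵀ` with `M⁻¹ = L`, and `M = X V` with `V` integral and `X` a matrix of determinant
one that differs from the identity only in the first `k` columns. -/
structure Factored (H : Matrix (Fin n) (Fin n) ℚ) (k : ℕ) (M W L : Matrix (Fin n) (Fin n) ℚ) :
    Prop where
  inv : M * L = 1
  eq : W = M * H * Mᵀ
  factor : ∃ (X : Matrix (Fin n) (Fin n) ℚ) (V : Matrix (Fin n) (Fin n) ℤ),
    M = X * V.map (Int.cast : ℤ → ℚ) ∧ X.det = 1 ∧
      ∀ i j : Fin n, k ≤ j → X i j = (1 : Matrix (Fin n) (Fin n) ℚ) i j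

theorem transvection_inv_mul {p q : Fin n} (hpq : p ≠ q) (c : ℚ) :
    transvection p q (-c) * transvection p q c = 1 := by
  rw [transvection_mul_transvection_same p q hpq]
  simp

section

variable {H M W L : Matrix (Fin n) (Fin n) ℚ} {k : ℕ} {p q : Fin n}

theorem inv_transvection (h : M * L = 1) (hpq : p ≠ q) (c : ℚ) :
    transvection p q c * M * (L * transvection p q (-c)) = 1 := by
  rw [Matrix.mul_assoc, ← Matrix.mul_assoc M, h, Matrix.one_mul]
  simpa using transvection_inv_mul hpq (-c)

theorem congruence_transvection (h : W = M * H * Mᵀ) (c : ℚ) :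
    transvection p q c * W * (transvection p q c)ᵀ =
      (transvection p q c * M) * H * (transvection p q c * M)ᵀ := by
  rw [h, transpose_mul]
  simp only [Matrix.mul_assoc]

/-- An integral elementary operation on the unreduced rows is absorbed by the integral factor. -/
theorem Factored.transvection_int (h : Factored H k M W L) (hpq : p ≠ q) (hp : k ≤ p)
    (c : ℤ) : Factored H k (transvection p q (c : ℚ) * M)
      (transvection p q (c : ℚ) * W * (transvection p q (c : ℚ))ᵀ)
      (L * transvection p q (-(c : ℚ))) := by
  refine ⟨inv_transvection h.inv hpq _, congruence_transvection h.eq _, ?_⟩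
  obtain ⟨X, V, hM, hdet, hX⟩ := h.factor
  refine ⟨transvection p q (c : ℚ) * X * transvection p q (-(c : ℚ)), transvection p q c * V, ?_,
    ?_, ?_⟩
  · have hT : (transvection p q c).map (Int.cast : ℤ → ℚ) = transvection p q (c : ℚ) := by
      ext i j
      simp [transvection, one_apply, single_apply, apply_ite (Int.cast : ℤ → ℚ)]
    have hmap : (transvection p q c * V).map (Int.cast : ℤ → ℚ) =
        transvection p q (c : ℚ) * V.map (Int.cast : ℤ → ℚ) := by
      rw [← hT]
      exact Matrix.map_mul (f := Int.castRingHom ℚ)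
    rw [hmap, hM]
    simp only [Matrix.mul_assoc]
    rw [← Matrix.mul_assoc (transvection p q (-(c : ℚ))), transvection_inv_mul hpq, Matrix.one_mul]
  · rw [det_mul, det_mul, det_transvection_of_ne _ _ hpq, det_transvection_of_ne _ _ hpq, hdet]
    norm_num
  · intro i j hj
    have h1 : ∀ i j : Fin n, k ≤ j → (transvection p q (c : ℚ) * X) i j =
        transvection p q (c : ℚ) i j := by
      intro i j hj
      rw [transvection_mul_apply, hX i j hj, hX q j hj]
      rw [← transvection_mul_apply, Matrix.mul_one]
    rw [mul_transvection_apply, h1 i j hj, h1 i p hp, ← mul_transvection_apply]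
    have := transvection_inv_mul hpq (-(c : ℚ))
    rw [neg_neg] at this
    rw [this]

/-- Subtracting a multiple of a reduced row is absorbed by the unipotent factor. -/
theorem Factored.transvection_elim (h : Factored H k M W L) (hpq : p ≠ q) (hq : (q : ℕ) < k)
    (c : ℚ) : Factored H k (transvection p q c * M)
      (transvection p q c * W * (transvection p q c)ᵀ) (L * transvection p q (-c)) := by
  refine ⟨inv_transvection h.inv hpq _, congruence_transvection h.eq _, ?_⟩
  obtain ⟨X, V, hM, hdet, hX⟩ := h.factor
  refine ⟨transvection p q c * X, V, by rw [hM, Matrix.mul_assoc], ?_, ?_⟩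
  · rw [det_mul, det_transvection_of_ne _ _ hpq, hdet, one_mul]
  · intro i j hj
    have hqj : q ≠ j := fun h => by subst h; omega
    rw [transvection_mul_apply, hX i j hj, hX q j hj, one_apply_ne hqj]
    simp

theorem Factored.mono {k' : ℕ} (h : Factored H k M W L) (hk : k ≤ k') : Factored H k' M W L := by
  refine ⟨h.inv, h.eq, ?_⟩
  obtain ⟨X, V, hM, hdet, hX⟩ := h.factor
  exact ⟨X, V, hM, hdet, fun i j hj => hX i j (hk.trans hj)⟩

theorem Factored.isSymm (h : Factored H k M W L) (hH : H.IsSymm) (i j : Fin n) :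
    W i j = W j i := by
  have : Wᵀ = W := by
    rw [h.eq, transpose_mul, transpose_mul, transpose_transpose, hH.eq, Matrix.mul_assoc]
  conv_lhs => rw [← this]
  rfl

/-- The entries of `M H Mᵀ` are at most `2 ^ wBits h`, where `h` is the encoding length of `H`: they
are sums of `n ^ 2 ≤ 2 ^ (2 * n)` products of an entry of `H` with two entries of `M`, which are at
most `2 ^ (2 * n + 4)`, and `n ≤ h`. -/
def wBits (h : ℕ) : ℕ := 7 * h + 8

/-- The common denominators are at most `2 ^ denBits h`: for a common denominator `g ≤ 2 ^ h` of the
entries of `H` they are products of `g` and at most `n + 1` pivots of `g • W`, which are at most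
`2 ^ (8 * h + 8)`. -/
def denBits (h : ℕ) : ℕ := (8 * h + 8) * (h + 1) + h

/-- A bound for the encoding lengths of the entries at the beginning and at the end of a stage. -/
def entryBits (h : ℕ) : ℕ := 2 * denBits h + wBits h + 3

/-- The situation after `k` rows and columns have been reduced. The lengths of the finished
diagonal entries and columns of `L` are recorded here because their denominators come from
earlier stages. -/
structure Reduced (H : Matrix (Fin n) (Fin n) ℚ) (k : ℕ) (M W L : Matrix (Fin n) (Fin n) ℚ) :
    Prop extends Factored H k M W L where
  diag : ∀ i j : Fin n, i ≠ j → (i : ℕ) < k ∨ (j : ℕ) < k → W i j = 0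
  pivot : ∀ i : Fin n, (i : ℕ) < k → W i i ≠ 0
  integral : ∀ i j : Fin n, k ≤ j → ∃ z : ℤ, L i j = z
  bitsW : ∀ i : Fin n, (i : ℕ) < k → ratBits (W i i) ≤ entryBits (matrixBits H)
  bitsL : ∀ i j : Fin n, (j : ℕ) < k → ratBits (L i j) ≤ entryBits (matrixBits H)
  absL : ∀ i j : Fin n, (j : ℕ) < k → |L i j| ≤ 2 ^ n

theorem Reduced.transvection_int (h : Reduced H k M W L) (hpq : p ≠ q) (hp : k ≤ p) (hq : k ≤ q)
    (c : ℤ) : Reduced H k (transvection p q (c : ℚ) * M)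
      (transvection p q (c : ℚ) * W * (transvection p q (c : ℚ))ᵀ)
      (L * transvection p q (-(c : ℚ))) := by
  have hlt : ∀ i r : Fin n, (i : ℕ) < k → k ≤ r → i ≠ r := fun i r h1 h2 h => by subst h; omega
  have hWii : ∀ i : Fin n, (i : ℕ) < k →
      (transvection p q (c : ℚ) * W * (transvection p q (c : ℚ))ᵀ) i i = W i i := by
    intro i hi
    rw [transvection_congruence_apply, if_neg (hlt i p hi hp), if_neg (hlt i p hi hp)]
    ring
  have hLj : ∀ i j : Fin n, (j : ℕ) < k → (L * transvection p q (-(c : ℚ))) i j = L i j := by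
    intro i j hj
    rw [mul_transvection_apply, if_neg (hlt j q hj hq), add_zero]
  refine ⟨h.toFactored.transvection_int hpq hp c, ?_, ?_, ?_, ?_, ?_, ?_⟩
  · intro i j hij hk
    rw [transvection_congruence_apply]
    rcases hk with hk | hk
    · have h1 := h.diag i q (hlt i q hk hq) (Or.inl hk)
      simp [hlt i p hk hp, h.diag i j hij (Or.inl hk), h1]
    · have h1 := h.diag q j (hlt j q hk hq).symm (Or.inr hk)
      simp [hlt j p hk hp, h.diag i j hij (Or.inr hk), h1]
  · intro i hi
    rw [hWii i hi]
    exact h.pivot i hi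
  · intro i j hj
    rw [mul_transvection_apply]
    obtain ⟨z, hz⟩ := h.integral i j hj
    obtain ⟨y, hy⟩ := h.integral i p hp
    split_ifs
    · exact ⟨z + -c * y, by rw [hz, hy]; push_cast; ring⟩
    · exact ⟨z, by rw [hz, add_zero]⟩
  · intro i hi
    rw [hWii i hi]
    exact h.bitsW i hi
  · intro i j hj
    rw [hLj i j hj]
    exact h.bitsL i j hj
  · intro i j hj
    rw [hLj i j hj]
    exact h.absL i j hj

/-- A common denominator of the unreduced entries, and of the multipliers that they give. -/
theorem Reduced.exists_den (h : Reduced H k M W L)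
    (hW : ∀ i j, |W i j| ≤ 2 ^ wBits (matrixBits H)) :
    (∃ d : ℤ, d ≠ 0 ∧ |(d : ℚ)| ≤ 2 ^ denBits (matrixBits H) ∧
      ∀ i j : Fin n, k ≤ i → k ≤ j → ∃ z : ℤ, W i j * d = z) ∧
    ∀ r : Fin n, k ≤ r → W r r ≠ 0 →
      ∃ d : ℤ, d ≠ 0 ∧ |(d : ℚ)| ≤ 2 ^ denBits (matrixBits H) ∧
        ∀ i : Fin n, k ≤ i → ∃ z : ℤ, W i r / W r r * d = z := by
  obtain ⟨g, hg0, hg, G, hG⟩ := exists_common_den H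
  obtain ⟨X, V, hM, hdet, hX⟩ := h.factor
  have hgq : (g : ℚ) ≠ 0 := by exact_mod_cast hg0
  have hgle : |(g : ℚ)| ≤ 2 ^ matrixBits H := by rw [Nat.abs_cast]; exact_mod_cast hg
  -- `g • W` arises from the integral matrix `V (g • H) Vᵀ`.
  obtain ⟨⟨δ, hδ⟩, hint⟩ := integral_schur_complement (fun i : Fin n => (i : ℕ) < k) (V * G * Vᵀ) X
    ((g : ℚ) • W) (fun i j hj => hX i j (not_lt.1 hj)) hdet (by
      have h1 : (V * G * Vᵀ).map (Int.cast : ℤ → ℚ) =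
          V.map (Int.cast : ℤ → ℚ) * G.map (Int.cast : ℤ → ℚ) * (V.map (Int.cast : ℤ → ℚ))ᵀ := by
        have h2 := Matrix.map_mul (L := V * G) (M := Vᵀ) (f := Int.castRingHom ℚ)
        have h3 := Matrix.map_mul (L := V) (M := G) (f := Int.castRingHom ℚ)
        rw [h3] at h2
        exact h2
      rw [h1, h.eq, hM, ← hG, transpose_mul]
      simp only [Matrix.mul_assoc, Matrix.smul_mul, Matrix.mul_smul])
    (fun i j hij hk => by simp [h.diag i j hij hk])
  have hδ0 : δ ≠ 0 := by
    have : (δ : ℚ) ≠ 0 := by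
      rw [← hδ]
      exact Finset.prod_ne_zero_iff.2 fun i _ => mul_ne_zero hgq (h.pivot i i.2)
    exact_mod_cast this
  have hgW : ∀ i j, |((g : ℚ) • W) i j| ≤ 2 ^ (8 * matrixBits H + 8) := by
    intro i j
    rw [Matrix.smul_apply, smul_eq_mul, abs_mul]
    refine (mul_le_mul hgle (hW i j) (abs_nonneg _) (by positivity)).trans (le_of_eq ?_)
    rw [← pow_add, wBits]
    congr 1
    ring
  have hδle : |(δ : ℚ)| ≤ 2 ^ ((8 * matrixBits H + 8) * matrixBits H) := by
    rw [← hδ, Finset.abs_prod]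
    refine (Finset.prod_le_prod (fun _ _ => abs_nonneg _) fun i _ => hgW i.1 i.1).trans ?_
    rw [Finset.prod_const, ← pow_mul]
    refine pow_le_pow_right₀ (by norm_num) (Nat.mul_le_mul_left _ ?_)
    refine le_trans ?_ (le_matrixBits H)
    rw [Finset.card_univ]
    exact (Fintype.card_subtype_le _).trans (by simp)
  refine ⟨⟨δ * g, mul_ne_zero hδ0 (by exact_mod_cast hg0), ?_, ?_⟩, ?_⟩
  · push_cast
    rw [abs_mul]
    refine (mul_le_mul hδle hgle (abs_nonneg _) (by positivity)).trans ?_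
    rw [← pow_add, denBits]
    refine pow_le_pow_right₀ (by norm_num) ?_
    ring_nf
    omega
  · intro i j hi hj
    obtain ⟨z, hz⟩ := hint i j (not_lt.2 hi) (not_lt.2 hj)
    refine ⟨z, ?_⟩
    rw [← hz, hδ, Matrix.smul_apply, smul_eq_mul]
    push_cast
    ring
  · intro r hr hpiv
    obtain ⟨d, hd⟩ := hint r r (not_lt.2 hr) (not_lt.2 hr)
    rw [hδ, Matrix.smul_apply, smul_eq_mul] at hd
    refine ⟨d, ?_, ?_, ?_⟩
    · have : (d : ℚ) ≠ 0 := by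
        rw [← hd]
        exact mul_ne_zero (by exact_mod_cast hδ0) (mul_ne_zero hgq hpiv)
      exact_mod_cast this
    · rw [← hd, abs_mul]
      refine (mul_le_mul hδle (hgW r r) (abs_nonneg _) (by positivity)).trans ?_
      rw [← pow_add, denBits]
      refine pow_le_pow_right₀ (by norm_num) ?_
      ring_nf
      omega
    · intro i hi
      obtain ⟨z, hz⟩ := hint i r (not_lt.2 hi) (not_lt.2 hr)
      refine ⟨z, ?_⟩
      rw [← hz, ← hd, hδ, Matrix.smul_apply, smul_eq_mul]
      field_simp

/-- The factor `16` leaves room for the four congruences of a stage that precede the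
elimination, each of which at most doubles the largest entry of `M`. -/
theorem three_pow_le {k : ℕ} (hk : k ≤ n) : (16 : ℚ) * 3 ^ k ≤ 2 ^ (2 * n + 4) := by
  have h1 : (3 : ℚ) ^ k ≤ 4 ^ n :=
    (pow_le_pow_left₀ (by norm_num) (by norm_num) k).trans (pow_le_pow_right₀ (by norm_num) hk)
  have h2 : (2 : ℚ) ^ (2 * n + 4) = 16 * 4 ^ n := by
    rw [pow_add, pow_mul]
    norm_num
    ring
  rw [h2]
  linarith

theorem Factored.abs_le (h : Factored H k M W L) {k' : ℕ} (hk : k' ≤ n)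
    (hM : ∀ i j, |M i j| ≤ 16 * 3 ^ k') (i j : Fin n) : |W i j| ≤ 2 ^ wBits (matrixBits H) := by
  have hM' : ∀ i j, |M i j| ≤ 2 ^ (2 * n + 4) := fun i j => (hM i j).trans (three_pow_le hk)
  have hH : ∀ i j, |H i j| ≤ 2 ^ matrixBits H := fun i j => (abs_le_two_pow_ratBits _).trans
    (pow_le_pow_right₀ (by norm_num) (ratBits_le_matrixBits H i j))
  have hn : (n : ℚ) ≤ 2 ^ n := by exact_mod_cast Nat.lt_two_pow_self.le
  have h1 : ∀ i j, |(M * H) i j| ≤ 2 ^ (n + (2 * n + 4) + matrixBits H) := by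
    intro i j
    rw [mul_apply]
    refine (Finset.abs_sum_le_sum_abs _ _).trans ((Finset.sum_le_card_nsmul _ _
      (2 ^ (2 * n + 4) * 2 ^ matrixBits H) fun a _ => ?_).trans ?_)
    · rw [abs_mul]
      exact mul_le_mul (hM' i a) (hH a j) (abs_nonneg _) (by positivity)
    · rw [Finset.card_univ, Fintype.card_fin, nsmul_eq_mul, pow_add _ (n + _), pow_add _ n,
        mul_assoc]
      exact mul_le_mul_of_nonneg_right hn (by positivity)
  rw [h.eq, mul_apply]
  refine (Finset.abs_sum_le_sum_abs _ _).trans ((Finset.sum_le_card_nsmul _ _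
    (2 ^ (n + (2 * n + 4) + matrixBits H) * 2 ^ (2 * n + 4)) fun a _ => ?_).trans ?_)
  · rw [abs_mul]
    exact mul_le_mul (h1 i a) (hM' j a) (abs_nonneg _) (by positivity)
  · rw [Finset.card_univ, Fintype.card_fin, nsmul_eq_mul, ← pow_add]
    refine (mul_le_mul_of_nonneg_right hn (by positivity)).trans ?_
    rw [← pow_add, wBits]
    refine pow_le_pow_right₀ (by norm_num) ?_
    have := le_matrixBits H
    omega

theorem Reduced.ratBits_W (h : Reduced H k M W L) {k' : ℕ} (hk : k' ≤ n)
    (hM : ∀ i j, |M i j| ≤ 16 * 3 ^ k') (i j : Fin n) :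
    ratBits (W i j) ≤ entryBits (matrixBits H) := by
  have hW := h.abs_le hk hM
  by_cases hij : (i : ℕ) < k ∨ (j : ℕ) < k
  · by_cases he : i = j
    · subst he
      exact h.bitsW i (by tauto)
    · rw [h.diag i j he hij, ratBits_zero, entryBits]
      omega
  · push Not at hij
    obtain ⟨d, hd, hdle, hz⟩ := (h.exists_den hW).1
    obtain ⟨z, hz⟩ := hz i j hij.1 hij.2
    exact ratBits_le_of_common_den hd hz hdle (hW i j)

theorem two_pow_le_wBits (H : Matrix (Fin n) (Fin n) ℚ) {k : ℕ} (hk : k ≤ n) :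
    (16 : ℚ) * 2 ^ k ≤ 2 ^ wBits (matrixBits H) := by
  have : (16 : ℚ) * 2 ^ k = 2 ^ (k + 4) := by rw [pow_add]; norm_num; ring
  rw [this]
  refine pow_le_pow_right₀ (by norm_num) ?_
  have := le_matrixBits H
  unfold wBits
  omega

theorem ratBits_le_entryBits_of_integral {x : ℚ} {z : ℤ} (hz : x = z) {k : ℕ} (hk : k ≤ n)
    (hx : |x| ≤ 16 * 2 ^ k) : ratBits x ≤ entryBits (matrixBits H) := by
  have := ratBits_le_of_common_den (x := x) (d := 1) (z := z) (a := 0) one_ne_zero (by simp [hz])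
    (by simp) (hx.trans (two_pow_le_wBits H hk))
  unfold entryBits
  omega

theorem Reduced.ratBits_L (h : Reduced H k M W L) {k' : ℕ} (hk : k' ≤ n)
    (hL : ∀ i j : Fin n, k ≤ j → |L i j| ≤ 16 * 2 ^ k') (i j : Fin n) :
    ratBits (L i j) ≤ entryBits (matrixBits H) := by
  by_cases hj : (j : ℕ) < k
  · exact h.bitsL i j hj
  · obtain ⟨z, hz⟩ := h.integral i j (not_lt.1 hj)
    exact ratBits_le_entryBits_of_integral hz hk (hL i j (not_lt.1 hj))

end

end RatRAM

/-! ### One stage of the reduction -/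

namespace RatRAM

open Matrix

variable {n : ℕ} {H M W L : Matrix (Fin n) (Fin n) ℚ} {k : ℕ} {p q : Fin n}

theorem abs_mul_le_of_abs_le_one {c x y : ℚ} (hc : |c| ≤ 1) (hx : |x| ≤ y) : |c * x| ≤ y := by
  rw [abs_mul]
  exact (mul_le_of_le_one_left (abs_nonneg _) hc).trans hx

theorem abs_transvection_mul_le {c : ℚ} {B : Fin n → ℚ} (hc : |c| ≤ 1)
    (hM : ∀ i j, |M i j| ≤ B i) (i j : Fin n) :
    |(transvection p q c * M) i j| ≤ if i = p then B p + B q else B i := by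
  rw [transvection_mul_apply]
  split_ifs with h
  · subst h
    exact (abs_add_le _ _).trans (add_le_add (hM _ _) (abs_mul_le_of_abs_le_one hc (hM _ _)))
  · simpa using hM i j

theorem abs_transvection_mul_le_two_mul {c B : ℚ} (hc : |c| ≤ 1) (hM : ∀ i j, |M i j| ≤ B)
    (i j : Fin n) : |(transvection p q c * M) i j| ≤ 2 * B := by
  have h := abs_transvection_mul_le (p := p) (q := q) (B := fun _ => B) hc hM i j
  have hB : 0 ≤ B := (abs_nonneg _).trans (hM i j)
  split_ifs at h <;> linarith

theorem abs_mul_transvection_le_two_mul {c B : ℚ} (hc : |c| ≤ 1) (hp : k ≤ p)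
    (hL : ∀ i j : Fin n, k ≤ j → |L i j| ≤ B) (i j : Fin n) (hj : k ≤ j) :
    |(L * transvection p q (-c)) i j| ≤ 2 * B := by
  have hB : 0 ≤ B := (abs_nonneg _).trans (hL i j hj)
  rw [mul_transvection_apply]
  split_ifs
  · have h1 := abs_mul_le_of_abs_le_one (by rwa [abs_neg] : |-c| ≤ 1) (hL i p hp)
    exact (abs_add_le _ _).trans (by linarith [hL i j hj])
  · rw [add_zero]
    linarith [hL i j hj]

/-- If `|W p q|` is maximal in the trailing block and `c = ±1` has a suitable sign, then the vector
`e_p + c e_q` gives a pivot of at least twice this size. The other entries of the new row `p` are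
sums of two old entries, and so the pivot dominates its row. -/
theorem pivot_dominates (hW : ∀ i j, W i j = W j i) (hpq : p ≠ q) (hp : k ≤ p) (hq : k ≤ q)
    (hmax : ∀ i j : Fin n, k ≤ i → k ≤ j → |W i j| ≤ |W p q|) {c : ℚ} (hc : c * c = 1)
    (hsign : 0 ≤ c * ((W p p + W q q) * W p q)) :
    2 * |W p q| ≤ |(transvection p q c * W * (transvection p q c)ᵀ) p p| ∧
      ∀ j : Fin n, k ≤ j → |(transvection p q c * W * (transvection p q c)ᵀ) p j| ≤
        |(transvection p q c * W * (transvection p q c)ᵀ) p p| := by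
  have hpp : (transvection p q c * W * (transvection p q c)ᵀ) p p =
      W p p + W q q + 2 * c * W p q := by
    rw [transvection_congruence_apply, if_pos rfl, if_pos rfl, if_pos rfl, hW q p]
    linear_combination W q q * hc
  have h2 : 2 * |W p q| ≤ |W p p + W q q + 2 * c * W p q| := by
    rw [show 2 * |W p q| = |2 * W p q| by rw [abs_mul]; norm_num]
    apply sq_le_sq.1
    have : (W p p + W q q + 2 * c * W p q) ^ 2 = (W p p + W q q) ^ 2 +
        4 * (c * ((W p p + W q q) * W p q)) + (2 * W p q) ^ 2 := by
      linear_combination 4 * W p q ^ 2 * hc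
    rw [this]
    nlinarith [sq_nonneg (W p p + W q q)]
  rw [hpp]
  refine ⟨h2, fun j hj => ?_⟩
  by_cases hjp : j = p
  · subst hjp
    rw [hpp]
  · have hc1 : |c| ≤ 1 := abs_le_one_iff_mul_self_le_one.2 hc.le
    rw [transvection_congruence_apply, if_pos rfl, if_neg hjp, add_zero]
    refine (abs_add_le _ _).trans (le_trans ?_ h2)
    have h3 := abs_mul_le_of_abs_le_one hc1 (hmax q j hq hj)
    have h4 := hmax p j hp hj
    linarith

/-- The product of three transvections that exchanges `k` and `p`, up to a sign. -/
def signedSwap (k p : Fin n) : Matrix (Fin n) (Fin n) ℚ :=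
  transvection k p 1 * (transvection p k (-1) * transvection k p 1)

theorem signedSwap_mul_apply {k p : Fin n} (hkp : k ≠ p) (A : Matrix (Fin n) (Fin n) ℚ)
    (i j : Fin n) : (signedSwap k p * A) i j =
      if i = k then A p j else if i = p then -A k j else A i j := by
  rw [signedSwap, Matrix.mul_assoc, Matrix.mul_assoc]
  simp only [transvection_mul_apply]
  by_cases h1 : i = k
  · subst h1
    simp [hkp, hkp.symm]
  · by_cases h2 : i = p
    · subst h2
      simp [h1]
    · simp [h1, h2]

theorem signedSwap_congruence_apply {k p : Fin n} (hkp : k ≠ p) (A : Matrix (Fin n) (Fin n) ℚ)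
    (j : Fin n) : (signedSwap k p * A * (signedSwap k p)ᵀ) k j =
      if j = k then A p p else if j = p then -A p k else A p j := by
  have h : signedSwap k p * A * (signedSwap k p)ᵀ =
      (signedSwap k p * (signedSwap k p * A)ᵀ)ᵀ := by
    rw [transpose_mul, transpose_transpose]
  rw [h, transpose_apply, signedSwap_mul_apply hkp]
  simp only [transpose_apply, signedSwap_mul_apply hkp, if_true]

theorem mul_signedSwap_inv_apply {k p : Fin n} (hkp : k ≠ p) (A : Matrix (Fin n) (Fin n) ℚ)
    (i j : Fin n) :
    (A * transvection k p (-1) * transvection p k 1 * transvection k p (-1) :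
      Matrix (Fin n) (Fin n) ℚ) i j =
        if j = k then A i p else if j = p then -A i k else A i j := by
  simp only [mul_transvection_apply]
  by_cases h1 : j = k
  · subst h1
    simp [hkp]
  · by_cases h2 : j = p
    · subst h2
      simp [h1, hkp]
    · simp [h1, h2]

/-- The situation in the elimination of column `k`, where the rows `i < r` have been treated. `W₀`
is the matrix at the start of the elimination and `d` is a common denominator of the multipliers.
Column `k` of `L` is a sum of at most `r - k` multiples of integral columns. -/
structure Eliminating (H : Matrix (Fin n) (Fin n) ℚ) (k : Fin n) (W₀ : Matrix (Fin n) (Fin n) ℚ)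
    (d : ℤ) (r : ℕ) (M W L : Matrix (Fin n) (Fin n) ℚ) : Prop
    extends Factored H (k + 1) M W L where
  absM : ∀ i j : Fin n, |M i j| ≤
    (if k < i ∧ (i : ℕ) < r then 3 else if i = k then 2 else 1) * 3 ^ (k : ℕ)
  formula : ∀ a : Fin n → ℚ, (∀ i, a i = if k < i ∧ (i : ℕ) < r then W₀ i k / W₀ k k else 0) →
    ∀ i j, W i j = W₀ i j - a i * W₀ k j - a j * W₀ i k + a i * a j * W₀ k k
  bitsL : ∀ i j : Fin n, j < k → ratBits (L i j) ≤ entryBits (matrixBits H)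
  absL : ∀ i j : Fin n, j < k → |L i j| ≤ 2 ^ n
  integral : ∀ i j : Fin n, k < j → ∃ z : ℤ, L i j = z
  absL_right : ∀ i j : Fin n, k < j → |L i j| ≤ 2 ^ ((k : ℕ) + 1)
  denL : ∀ i : Fin n, ∃ z : ℤ, L i k * d = z
  absL_col : ∀ i : Fin n, |L i k| ≤ ((r - k : ℕ) : ℚ) * 2 ^ ((k : ℕ) + 1)

variable {k : Fin n} {W₀ : Matrix (Fin n) (Fin n) ℚ} {d : ℤ}

theorem Reduced.eliminating (h : Reduced H k M W L)
    (hM : ∀ i j, |M i j| ≤ (if i = k then 2 else 1) * 3 ^ (k : ℕ))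
    (hL : ∀ i j : Fin n, k ≤ j → |L i j| ≤ 2 ^ ((k : ℕ) + 1)) :
    Eliminating H k W d (k + 1) M W L where
  toFactored := h.toFactored.mono (Nat.le_succ _)
  absM i j := by
    rw [if_neg (by rw [Fin.lt_def]; omega)]
    exact hM i j
  formula a ha i j := by
    have h0 : ∀ i, a i = 0 := fun i => by
      rw [ha i, if_neg (by rw [Fin.lt_def]; omega)]
    rw [h0, h0]
    ring
  bitsL := h.bitsL
  absL := h.absL
  integral i j hj := h.integral i j hj.le
  absL_right i j hj := hL i j hj.le
  denL i := by
    obtain ⟨z, hz⟩ := h.integral i k le_rfl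
    exact ⟨z * d, by rw [hz]; push_cast; ring⟩
  absL_col i := by simpa using hL i k le_rfl

variable {r : Fin n}

theorem Eliminating.multiplier (h : Eliminating H k W₀ d r M W L) :
    W r k = W₀ r k ∧ W k k = W₀ k k := by
  have h1 := h.formula _ (fun _ => rfl)
  constructor
  · rw [h1]; simp
  · rw [h1]; simp

theorem Eliminating.step (h : Eliminating H k W₀ d r M W L) (hr : k < r)
    (hdom : |W₀ r k| ≤ |W₀ k k|)
    (hden : ∃ z : ℤ, W₀ r k / W₀ k k * d = z) {c : ℚ} (hc : c = -(W r k / W k k)) :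
    Eliminating H k W₀ d (r + 1) (transvection r k c * M)
      (transvection r k c * W * (transvection r k c)ᵀ) (L * transvection r k (-c)) := by
  obtain ⟨hm1, hm2⟩ := h.multiplier
  rw [hm1, hm2] at hc
  have hc1 : |c| ≤ 1 := by
    rw [hc, abs_neg, abs_div]
    exact div_le_one_of_le₀ hdom (abs_nonneg _)
  have hlt : ∀ i : Fin n, i ≠ r → (((i : ℕ) < r + 1) ↔ (i : ℕ) < r) := fun i hi => by
    have : (i : ℕ) ≠ r := fun h => hi (Fin.ext h)
    omega
  have hLne : ∀ i j : Fin n, j ≠ k → (L * transvection r k (-c)) i j = L i j := fun i j hj => by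
    rw [mul_transvection_apply, if_neg hj, add_zero]
  refine ⟨h.toFactored.transvection_elim hr.ne' (Nat.lt_succ_self _) c, ?_, ?_, ?_, ?_, ?_, ?_, ?_,
    ?_⟩
  · intro i j
    refine (abs_transvection_mul_le hc1 h.absM i j).trans (le_of_eq ?_)
    by_cases hi : i = r
    · subst hi
      have h1 : (k : Fin n) < i ∧ (i : ℕ) < i + 1 := ⟨hr, Nat.lt_succ_self _⟩
      have h2 : ¬ ((k : Fin n) < k ∧ (k : ℕ) < i) := fun h => lt_irrefl _ h.1
      rw [if_pos rfl, if_pos h1, if_neg fun h => lt_irrefl _ h.2, if_neg hr.ne', if_neg h2,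
        if_pos rfl]
      ring
    · simp only [if_neg hi, hlt i hi]
  · intro a ha i j
    set a' : Fin n → ℚ := fun i => if k < i ∧ (i : ℕ) < r then W₀ i k / W₀ k k else 0 with ha'
    have har : ∀ i, a i = a' i + if i = r then -c else 0 := fun i => by
      rw [ha i, ha']
      by_cases hi : i = r
      · subst hi
        simp [hr, hc]
      · simp [hlt i hi, hi]
    have hak : a' k = 0 := by simp [ha']
    have harr : a' r = 0 := by simp [ha']
    have hf := h.formula a' (fun _ => rfl)
    rw [transvection_congruence_apply, hf i j, hf k j, hf i k, hf k k, hak, har i, har j]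
    split_ifs <;> ring
  · intro i j hj
    rw [hLne i j hj.ne]
    exact h.bitsL i j hj
  · intro i j hj
    rw [hLne i j hj.ne]
    exact h.absL i j hj
  · intro i j hj
    rw [hLne i j hj.ne']
    exact h.integral i j hj
  · intro i j hj
    rw [hLne i j hj.ne']
    exact h.absL_right i j hj
  · intro i
    rw [mul_transvection_apply, if_pos rfl]
    obtain ⟨z, hz⟩ := h.denL i
    obtain ⟨y, hy⟩ := hden
    obtain ⟨x, hx⟩ := h.integral i r hr
    refine ⟨z + y * x, ?_⟩
    push_cast
    rw [← hz, ← hy, ← hx, hc]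
    ring
  · intro i
    rw [mul_transvection_apply, if_pos rfl]
    have h1 := h.absL_col i
    have h2 := abs_mul_le_of_abs_le_one (by rwa [abs_neg] : |-c| ≤ 1) (h.absL_right i r hr)
    have h3 : ((r + 1 - k : ℕ) : ℚ) = ((r - k : ℕ) : ℚ) + 1 := by
      rw [Fin.lt_def] at hr
      rw [Nat.succ_sub (by omega)]
      push_cast
      ring
    rw [h3, add_mul, one_mul]
    exact (abs_add_le _ _).trans (add_le_add h1 h2)

/-- The bound for the column that is finished in stage `k` does not exceed `2 ^ n`, since
`m - k ≤ 2 ^ (m - k - 1)`. -/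
theorem absL_col_le {m : ℕ} (hk : (k : ℕ) < m) (hm : m ≤ n) :
    ((m - k : ℕ) : ℚ) * 2 ^ ((k : ℕ) + 1) ≤ 2 ^ n := by
  have h1 : m - k ≤ 2 ^ (m - k - 1) := by
    have := Nat.lt_two_pow_self (n := m - k - 1)
    omega
  have h2 : ((m - k : ℕ) : ℚ) ≤ 2 ^ (m - k - 1) := by exact_mod_cast h1
  refine (mul_le_mul_of_nonneg_right h2 (by positivity)).trans ?_
  rw [← pow_add]
  exact pow_le_pow_right₀ (by norm_num) (by omega)

theorem Eliminating.ratBits_L {m : ℕ} (h : Eliminating H k W₀ d m M W L) (hk : (k : ℕ) < m)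
    (hm : m ≤ n) (hd : d ≠ 0) (hdle : |(d : ℚ)| ≤ 2 ^ denBits (matrixBits H)) (i j : Fin n) :
    ratBits (L i j) ≤ entryBits (matrixBits H) := by
  have hn : (2 : ℚ) ^ n ≤ 16 * 2 ^ n := by linarith [pow_pos (two_pos : (0 : ℚ) < 2) n]
  rcases lt_trichotomy j k with hj | rfl | hj
  · exact h.bitsL i j hj
  · obtain ⟨z, hz⟩ := h.denL i
    exact ratBits_le_of_common_den hd hz hdle
      ((h.absL_col i).trans ((absL_col_le hk hm).trans (hn.trans (two_pow_le_wBits H le_rfl))))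
  · obtain ⟨z, hz⟩ := h.integral i j hj
    refine ratBits_le_entryBits_of_integral hz le_rfl ((h.absL_right i j hj).trans ?_)
    exact (pow_le_pow_right₀ (by norm_num) k.2).trans hn

/-- Between the congruences of an elimination the denominators are not controlled, but every entry
is obtained from entries of `W₀` by boundedly many operations. -/
theorem Eliminating.ratBits_W {m : ℕ} (h : Eliminating H k W₀ d m M W L) {b : ℕ}
    (hb : ∀ i j, ratBits (W₀ i j) ≤ b) (i j : Fin n) : ratBits (W i j) ≤ 54 * b := by
  set a : Fin n → ℚ := fun i => if k < i ∧ (i : ℕ) < m then W₀ i k / W₀ k k else 0 with ha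
  have hab : ∀ i, ratBits (a i) ≤ 2 * b := by
    intro i
    simp only [ha]
    have h1 := hb i k
    have h2 := hb k k
    have h3 := ratBits_div_le (W₀ i k) (W₀ k k)
    have h4 := two_le_ratBits (W₀ k k)
    split_ifs
    · omega
    · rw [ratBits_zero]; omega
  rw [h.formula a (fun _ => rfl)]
  have h1 := hb i j
  have h2 := hb k j
  have h3 := hb i k
  have h4 := hb k k
  have h5 := hab i
  have h6 := hab j
  have h7 := ratBits_mul_le (a i) (W₀ k j)
  have h8 := ratBits_mul_le (a j) (W₀ i k)
  have h9 := ratBits_mul_le (a i) (a j)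
  have h10 := ratBits_mul_le (a i * a j) (W₀ k k)
  have h11 := ratBits_sub_le (W₀ i j) (a i * W₀ k j)
  have h12 := ratBits_sub_le (W₀ i j - a i * W₀ k j) (a j * W₀ i k)
  have h13 := ratBits_add_le (W₀ i j - a i * W₀ k j - a j * W₀ i k) (a i * a j * W₀ k k)
  omega

/-- The end of an elimination is the beginning of the next stage. -/
theorem Eliminating.reduced (h : Eliminating H k W₀ d n M W L) (hd : d ≠ 0)
    (hdle : |(d : ℚ)| ≤ 2 ^ denBits (matrixBits H)) (hW₀ : ∀ i j, W₀ i j = W₀ j i)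
    (hdiag : ∀ i j : Fin n, i ≠ j → i < k ∨ j < k → W₀ i j = 0)
    (hpivot : ∀ i : Fin n, i ≤ k → W₀ i i ≠ 0)
    (hbits : ∀ i : Fin n, ratBits (W₀ i i) ≤ entryBits (matrixBits H)) :
    Reduced H (k + 1) M W L ∧ (∀ i j, |M i j| ≤ 3 ^ ((k : ℕ) + 1)) ∧
      ∀ i j : Fin n, (k : ℕ) + 1 ≤ j → |L i j| ≤ 2 ^ ((k : ℕ) + 1) := by
  set a : Fin n → ℚ := fun i => if k < i ∧ (i : ℕ) < n then W₀ i k / W₀ k k else 0 with ha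
  have hf := h.formula a (fun _ => rfl)
  have ha1 : ∀ i, k < i → a i = W₀ i k / W₀ k k := fun i hi => by simp [ha, hi]
  have ha2 : ∀ i, i ≤ k → a i = 0 := fun i hi => by simp [ha, not_lt.2 hi]
  have hWii : ∀ i, i ≤ k → W i i = W₀ i i := fun i hi => by
    rw [hf, ha2 i hi]
    ring
  have hpk := hpivot k le_rfl
  have key : ∀ i j : Fin n, i ≠ j → i ≤ k → W i j = 0 := by
    intro i j hij hi
    rw [hf, ha2 i hi]
    rcases hi.lt_or_eq with hlt | rfl
    · rw [hdiag i j hij (Or.inl hlt), hdiag i k hlt.ne (Or.inl hlt)]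
      ring
    · rcases lt_or_gt_of_ne hij with hj | hj
      · rw [ha1 j hj, hW₀ i j]
        field_simp
        ring
      · rw [ha2 j hj.le, hdiag i j hij (Or.inr hj)]
        ring
  have keyS : ∀ i j, W i j = W j i := fun i j => by
    rw [hf i j, hf j i, hW₀ i j, hW₀ k j, hW₀ i k]
    ring
  refine ⟨⟨h.toFactored, ?_, ?_, ?_, ?_, ?_, ?_⟩, ?_, ?_⟩
  · rintro i j hij (hi | hj)
    · exact key i j hij (Fin.le_def.2 (by omega))
    · rw [keyS]
      exact key j i hij.symm (Fin.le_def.2 (by omega))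
  · intro i hi
    have hik : i ≤ k := Fin.le_def.2 (by omega)
    rw [hWii i hik]
    exact hpivot i hik
  · intro i j hj
    exact h.integral i j (Fin.lt_def.2 (by omega))
  · intro i hi
    rw [hWii i (Fin.le_def.2 (by omega))]
    exact hbits i
  · intro i j _
    exact h.ratBits_L k.2 le_rfl hd hdle i j
  · intro i j hj
    rcases (Fin.le_def.2 (by omega) : j ≤ k).lt_or_eq with hlt | rfl
    · exact h.absL i j hlt
    · exact (h.absL_col i).trans (absL_col_le j.2 le_rfl)
  · intro i j
    refine (h.absM i j).trans ?_
    rw [pow_succ']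
    refine mul_le_mul_of_nonneg_right ?_ (by positivity)
    split_ifs <;> norm_num
  · intro i j hj
    exact h.absL_right i j (Fin.lt_def.2 (by omega))

end RatRAM

/-! ### The stages on the machine -/

namespace RatRAM

open Matrix

variable {n b : ℕ}

theorem State.matrix_congr {σ τ : State} {x : ℕ} (h : ∀ a, a.1 = x → τ.mem a = σ.mem a) :
    τ.matrix n x = σ.matrix n x := by
  ext i j
  exact h _ rfl

theorem Frame.congr {σ τ : State} (hF : Frame n σ)
    (hi : ∀ r, r = 0 ∨ 6 ≤ r → τ.idx r = σ.idx r)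
    (hm : ∀ a, a.1 = 2 ∨ a.1 = 7 → τ.mem a = σ.mem a) : Frame n τ where
  h0 := (hi 0 (by norm_num)).trans hF.h0
  h6 := (hi 6 (by norm_num)).trans hF.h6
  h7 := (hi 7 (by norm_num)).trans hF.h7
  h8 := (hi 8 (by norm_num)).trans hF.h8
  hz := (hm _ (Or.inr rfl)).trans hF.hz
  hD a ha := (hm a (Or.inl ha)).trans (hF.hD a ha)

/-- The congruence by `1 + v e_p e_qᵀ` for a constant `v`. -/
def Program.congruenceConst (v : ℚ) (rp rq : ℕ) : Program :=
  .seq (.setRat ⟨4, 8, 8⟩ (.const v)) (.congruence rp rq)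

variable {H : Matrix (Fin n) (Fin n) ℚ} {k : Fin n}

theorem three_le_entryBits (h : ℕ) : 3 ≤ entryBits h := by
  unfold entryBits
  omega

theorem wp_congruenceConst {rp rq : ℕ} {p q : Fin n} {v : ℚ} {Q : State → Prop} {σ : State}
    {M : Matrix (Fin n) (Fin n) ℚ}
    (hb : 26 * entryBits (matrixBits H) ≤ b) (hF : Frame n σ) (hrp : rp ≠ 5) (hrq : rq ≠ 5)
    (hp : σ.idx rp = p) (hq : σ.idx rq = q) (hpq : p ≠ q) (hkp : k ≤ p) (hkq : k ≤ q)
    (hv : v = 1 ∨ v = -1) (hR : Reduced H k M (σ.matrix n 0) (σ.matrix n 1))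
    (hM : ∀ i j, |M i j| ≤ 16 * 3 ^ (k : ℕ))
    (hL : ∀ i j : Fin n, k ≤ j → |σ.matrix n 1 i j| ≤ 16 * 2 ^ (k : ℕ))
    (hQ : ∀ τ : State, Frame n τ → (∀ r, r ≠ 5 → τ.idx r = σ.idx r) →
      τ.matrix n 0 = transvection p q v * σ.matrix n 0 * (transvection p q v)ᵀ →
      τ.matrix n 1 = σ.matrix n 1 * transvection p q (-v) →
      Reduced H k (transvection p q v * M) (τ.matrix n 0) (τ.matrix n 1) → Q τ) :
    WP n b (.congruenceConst v rp rq) (12 * n + 8) Q σ := by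
  have h3 := three_le_entryBits (matrixBits H)
  have hvb : ratBits v ≤ 3 := by rcases hv with rfl | rfl <;> simp
  refine (wp_seq (t := 1) (t' := 12 * n + 7) (wp_setRat (v := v) (by norm_num) rfl (by omega)
    ?_)).mono_time (by omega)
  have e4 : σ.addr ⟨4, 8, 8⟩ = (4, 0, 0) := by simp [State.addr, hF.h8]
  have m1 : ∀ a, (σ.updateRat ⟨4, 8, 8⟩ v).mem a = if a = (4, 0, 0) then v else σ.mem a :=
    fun a => by rw [State.updateRat_mem, e4]
  have m2 : ∀ a, a.1 ≠ 4 → (σ.updateRat ⟨4, 8, 8⟩ v).mem a = σ.mem a := fun a ha => by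
    rw [m1, if_neg fun h => ha (by rw [h])]
  have w0 : (σ.updateRat ⟨4, 8, 8⟩ v).matrix n 0 = σ.matrix n 0 :=
    State.matrix_congr fun a ha => m2 a (by omega)
  have w1 : (σ.updateRat ⟨4, 8, 8⟩ v).matrix n 1 = σ.matrix n 1 :=
    State.matrix_congr fun a ha => m2 a (by omega)
  have hF1 : Frame n (σ.updateRat ⟨4, 8, 8⟩ v) :=
    hF.congr (fun _ _ => rfl) fun a ha => m2 a (by omega)
  have hc : (σ.updateRat ⟨4, 8, 8⟩ v).mem (4, 0, 0) = v := by simp [m1]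
  refine wp_congruence (b₁ := entryBits (matrixBits H)) hF1 hrp hrq hp hq hpq hb ?_ ?_ ?_ ?_
  · rw [hc]; omega
  · rw [w0]; exact hR.ratBits_W k.2.le hM
  · rw [w1]; exact hR.ratBits_L k.2.le hL
  · rw [hc, w0, w1]
    intro τ h1 h2 h3 h4
    refine hQ τ (hF1.congr (fun r hr => h1 r (by omega)) fun a ha =>
      h2 a (by omega) (by omega) (by omega) (by omega)) h1 h3 h4 ?_
    rw [h3, h4]
    rcases hv with rfl | rfl
    · simpa using hR.transvection_int hpq hkp hkq 1
    · simpa using hR.transvection_int hpq hkp hkq (-1)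

/-- After `k` stages: the matrices in the memory, and the bounds for `M = L⁻¹` and for the
columns of `L` that are still to be processed. -/
structure Core (H : Matrix (Fin n) (Fin n) ℚ) (k : ℕ) (σ : State) : Prop where
  frame : Frame n σ
  idx : σ.idx 1 = k
  reduced : ∃ M, Reduced H k M (σ.matrix n 0) (σ.matrix n 1) ∧ (∀ i j, |M i j| ≤ 3 ^ k) ∧
    ∀ i j : Fin n, k ≤ j → |σ.matrix n 1 i j| ≤ 2 ^ k

/-- In stage `k`: row `p` of the trailing block has a nonzero diagonal entry of largest absolute
value. -/
structure Dominant (H : Matrix (Fin n) (Fin n) ℚ) (k p : Fin n) (σ : State) : Prop where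
  frame : Frame n σ
  idx : σ.idx 1 = k
  reduced : ∃ M, Reduced H k M (σ.matrix n 0) (σ.matrix n 1) ∧
    (∀ i j, |M i j| ≤ (if i = p then 2 else 1) * 3 ^ (k : ℕ)) ∧
    ∀ i j : Fin n, k ≤ j → |σ.matrix n 1 i j| ≤ 2 ^ ((k : ℕ) + 1)
  ne_zero : σ.matrix n 0 p p ≠ 0
  le_pivot : ∀ j, k ≤ j → |σ.matrix n 0 p j| ≤ |σ.matrix n 0 p p|

/-- If the position `(p, q)` in the registers `2` and `3` is not on the diagonal, add `±` row `q` to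
row `p`, with the sign that makes the diagonal entry large. -/
def Program.enlarge : Program :=
  .ite (.idxLt 2 3)
    (.seq (.setRat ⟨3, 8, 8⟩ (.add ⟨0, 2, 2⟩ ⟨0, 3, 3⟩))
      (.seq (.setRat ⟨3, 8, 8⟩ (.mul ⟨3, 8, 8⟩ ⟨0, 2, 3⟩))
        (.ite (.ratLe ⟨7, 8, 8⟩ ⟨3, 8, 8⟩) (.congruenceConst 1 2 3) (.congruenceConst (-1) 2 3))))
    .skip

theorem wp_enlarge {p q : Fin n} {σ : State} (hH : H.IsSymm)
    (hb : 26 * entryBits (matrixBits H) ≤ b) (hC : Core H k σ) (h2 : σ.idx 2 = p)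
    (h3 : σ.idx 3 = q) (hkp : k ≤ p) (hpq : p ≤ q)
    (hmax : ∀ i j : Fin n, k ≤ i → k ≤ j → |σ.matrix n 0 i j| ≤ |σ.matrix n 0 p q|)
    (hne : σ.matrix n 0 p q ≠ 0) :
    WP n b .enlarge (12 * n + 12) (fun τ => τ.idx 2 = p ∧ Dominant H k p τ) σ := by
  obtain ⟨hF, h1, M, hR, hM, hL⟩ := hC
  have hs3 : (1 : ℚ) ≤ 3 ^ (k : ℕ) := one_le_pow₀ (by norm_num)
  have hs2 : (1 : ℚ) ≤ 2 ^ (k : ℕ) := one_le_pow₀ (by norm_num)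
  have hM' : ∀ i j, |M i j| ≤ 16 * 3 ^ (k : ℕ) := fun i j => (hM i j).trans (by linarith)
  have hL' : ∀ i j : Fin n, k ≤ j → |σ.matrix n 1 i j| ≤ 16 * 2 ^ (k : ℕ) :=
    fun i j hj => (hL i j hj).trans (by linarith)
  refine (wp_ite (t := 1 + (1 + (12 * n + 8 + 1))) (fun hT => ?_) fun hT => ?_).mono_time (by omega)
  · have hne' : p ≠ q := by
      rintro rfl
      simp [Test.Holds, h2, h3] at hT
    have hbits := hR.ratBits_W k.2.le hM'
    have e3 : σ.addr ⟨3, 8, 8⟩ = (3, 0, 0) := by simp [State.addr, hF.h8]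
    set x := σ.matrix n 0 p p + σ.matrix n 0 q q with hx
    have hxb : ratBits x ≤ 4 * entryBits (matrixBits H) := by
      have h4 := ratBits_add_le (σ.matrix n 0 p p) (σ.matrix n 0 q q)
      have h5 := hbits p p
      have h6 := hbits q q
      rw [hx]
      omega
    have hyb : ratBits (x * σ.matrix n 0 p q) ≤ 5 * entryBits (matrixBits H) := by
      have h4 := ratBits_mul_le x (σ.matrix n 0 p q)
      have h5 := hbits p q
      omega
    refine wp_seq (wp_setRat (v := x) (by norm_num)
      (by simp [RatExpr.eval, State.get, State.addr, h2, h3, hx, State.matrix]) (by omega) ?_)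
    refine wp_seq (wp_setRat (v := x * σ.matrix n 0 p q) (by norm_num)
      (by simp [RatExpr.eval, State.get, State.addr, h2, h3, hF.h8, State.matrix]) (by omega) ?_)
    set σ₁ := (σ.updateRat ⟨3, 8, 8⟩ x).updateRat ⟨3, 8, 8⟩ (x * σ.matrix n 0 p q) with hσ₁
    have m1 : ∀ a, a.1 ≠ 3 → σ₁.mem a = σ.mem a := fun a ha => by
      have h3 : a ≠ (3, 0, 0) := fun h => ha (by rw [h])
      simp [hσ₁, State.addr, hF.h8, h3]
    have m3 : σ₁.mem (3, 0, 0) = x * σ.matrix n 0 p q := by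
      simp [hσ₁, State.addr, hF.h8]
    have i1 : σ₁.idx = σ.idx := rfl
    have w0 : σ₁.matrix n 0 = σ.matrix n 0 := State.matrix_congr fun a ha => m1 a (by omega)
    have w1 : σ₁.matrix n 1 = σ.matrix n 1 := State.matrix_congr fun a ha => m1 a (by omega)
    have hF1 : Frame n σ₁ := hF.congr (fun _ _ => rfl) fun a ha => m1 a (by omega)
    have main : ∀ v : ℚ, (v = 1 ∨ v = -1) → 0 ≤ v * (x * σ.matrix n 0 p q) →
        WP n b (.congruenceConst v 2 3) (12 * n + 8)
          (fun τ => τ.idx 2 = p ∧ Dominant H k p τ) σ₁ := by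
      intro v hv hsign
      have hvv : v * v = 1 := by rcases hv with rfl | rfl <;> norm_num
      have hv1 : |v| ≤ 1 := by rcases hv with rfl | rfl <;> norm_num
      refine wp_congruenceConst (p := p) (q := q) hb hF1 (by norm_num) (by norm_num) h2 h3 hne' hkp
        (hkp.trans hpq) hv (by rw [w0, w1]; exact hR) hM' (by rw [w1]; exact hL') ?_
      intro τ t1 t2 t3 t4 t5
      rw [w0] at t3
      obtain ⟨d1, d2⟩ := pivot_dominates (hR.isSymm hH) hne' (Fin.le_def.1 hkp)
        (Fin.le_def.1 (hkp.trans hpq)) (fun i j hi hj => hmax i j hi hj) hvv hsign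
      rw [← t3] at d1 d2
      refine ⟨(t2 2 (by norm_num)).trans h2, t1, (t2 1 (by norm_num)).trans h1, ⟨_, t5, ?_, ?_⟩,
        ?_, d2⟩
      · intro i j
        refine (abs_transvection_mul_le (B := fun _ => 3 ^ (k : ℕ)) hv1 hM i j).trans (le_of_eq ?_)
        split_ifs <;> ring
      · rw [t4, w1, pow_succ']
        exact fun i j hj => abs_mul_transvection_le_two_mul hv1 (Fin.le_def.1 hkp) hL i j hj
      · intro h0
        rw [h0, abs_zero] at d1
        exact hne (abs_eq_zero.1 (le_antisymm (by linarith) (abs_nonneg _)))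
    refine wp_ite (fun hT => main 1 (Or.inl rfl) ?_) fun hT => main (-1) (Or.inr rfl) ?_
    · simpa [Test.Holds, State.get, State.addr, i1, hF.h8, m3, hF1.hz] using hT
    · have : x * σ.matrix n 0 p q < 0 := by
        simpa [Test.Holds, State.get, State.addr, i1, hF.h8, m3, hF1.hz] using hT
      linarith
  · have hpq' : p = q := by
      simp only [Test.Holds, h2, h3, not_lt] at hT
      exact le_antisymm hpq hT
    subst hpq'
    refine (wp_skip ⟨h2, hF, h1, ⟨M, hR, ?_, ?_⟩, hne, fun j hj => hmax p j hkp hj⟩).mono_time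
      (by omega)
    · intro i j
      refine (hM i j).trans (le_mul_of_one_le_left (by positivity) ?_)
      split_ifs <;> norm_num
    · intro i j hj
      refine (hL i j hj).trans (pow_le_pow_right₀ (by norm_num) (Nat.le_succ _))

/-- Move the pivot from row `p` to row `k` by an exchange with a sign. -/
def Program.exchange : Program :=
  .ite (.idxLt 1 2)
    (.seq (.congruenceConst 1 1 2) (.seq (.congruenceConst (-1) 2 1) (.congruenceConst 1 1 2)))
    .skip

theorem wp_exchange {p : Fin n} {σ : State} (hb : 26 * entryBits (matrixBits H) ≤ b)
    (hD : Dominant H k p σ) (h2 : σ.idx 2 = p) (hkp : k ≤ p) :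
    WP n b .exchange (36 * n + 25) (Dominant H k k) σ := by
  obtain ⟨hF, h1, ⟨M, hR, hM, hL⟩, hne, hdom⟩ := hD
  have hs3 : (1 : ℚ) ≤ 3 ^ (k : ℕ) := one_le_pow₀ (by norm_num)
  have hs2 : (1 : ℚ) ≤ 2 ^ (k : ℕ) := one_le_pow₀ (by norm_num)
  have hM1 : ∀ i j, |M i j| ≤ 2 * 3 ^ (k : ℕ) := fun i j => by
    refine (hM i j).trans ?_
    split_ifs <;> linarith
  have hL1 : ∀ i j : Fin n, k ≤ j → |σ.matrix n 1 i j| ≤ 2 * 2 ^ (k : ℕ) :=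
    fun i j hj => (hL i j hj).trans (by rw [pow_succ'])
  refine (wp_ite (t := 12 * n + 8 + (12 * n + 8 + (12 * n + 8))) (fun hT => ?_)
    fun hT => ?_).mono_time (by omega)
  · have hne' : k ≠ p := by
      rintro rfl
      simp [Test.Holds, h1, h2] at hT
    refine wp_seq (wp_congruenceConst (p := k) (q := p) hb hF (by norm_num) (by norm_num) h1 h2 hne'
      le_rfl hkp (Or.inl rfl) hR (fun i j => (hM1 i j).trans (by linarith))
      (fun i j hj => (hL1 i j hj).trans (by linarith)) ?_)
    intro σ₁ f1 i1 w1 l1 r1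
    have hM2 := abs_transvection_mul_le_two_mul (p := k) (q := p) (c := 1) (by norm_num) hM1
    have hL2 := abs_mul_transvection_le_two_mul (k := k) (p := k) (q := p) (c := 1) (by norm_num)
      le_rfl hL1
    rw [← l1] at hL2
    refine wp_seq (wp_congruenceConst (p := p) (q := k) hb f1 (by norm_num) (by norm_num)
      ((i1 2 (by norm_num)).trans h2) ((i1 1 (by norm_num)).trans h1) hne'.symm
      hkp le_rfl (Or.inr rfl) r1 (fun i j => (hM2 i j).trans (by linarith))
      (fun i j hj => (hL2 i j hj).trans (by linarith)) ?_)
    intro σ₂ f2 i2 w2 l2 r2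
    have hM3 := abs_transvection_mul_le_two_mul (p := p) (q := k) (c := -1) (by norm_num) hM2
    have hL3 := abs_mul_transvection_le_two_mul (k := k) (p := p) (q := k) (c := -1) (by norm_num)
      (Fin.le_def.1 hkp) hL2
    rw [← l2] at hL3
    refine wp_congruenceConst (p := k) (q := p) hb f2 (by norm_num) (by norm_num)
      ((i2 1 (by norm_num)).trans ((i1 1 (by norm_num)).trans h1))
      ((i2 2 (by norm_num)).trans ((i1 2 (by norm_num)).trans h2)) hne'
      le_rfl hkp (Or.inl rfl) r2 (fun i j => (hM3 i j).trans (by linarith))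
      (fun i j hj => (hL3 i j hj).trans (by linarith)) ?_
    intro σ₃ f3 i3 w3 l3 r3
    have hW : σ₃.matrix n 0 = signedSwap k p * σ.matrix n 0 * (signedSwap k p)ᵀ := by
      rw [w3, w2, w1, signedSwap]
      simp only [transpose_mul, Matrix.mul_assoc]
    have hWk : ∀ j, σ₃.matrix n 0 k j = if j = k then σ.matrix n 0 p p
        else if j = p then -σ.matrix n 0 p k else σ.matrix n 0 p j := fun j => by
      rw [hW, signedSwap_congruence_apply hne']
    refine ⟨f3, (i3 1 (by norm_num)).trans ((i2 1 (by norm_num)).trans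
      ((i1 1 (by norm_num)).trans h1)), ⟨_, r3, ?_, ?_⟩, ?_, ?_⟩
    · intro i j
      have h5 : transvection k p 1 * (transvection p k (-1) * (transvection k p 1 * M)) =
          signedSwap k p * M := by
        rw [signedSwap]
        simp only [Matrix.mul_assoc]
      rw [h5, signedSwap_mul_apply hne']
      by_cases hi : i = k
      · simpa [hi] using hM p j
      · rw [if_neg hi, if_neg hi]
        by_cases hip : i = p
        · rw [if_pos hip, abs_neg]
          simpa [hne'] using hM k j
        · rw [if_neg hip]
          simpa [hip] using hM i j
    · intro i j hj
      rw [l3, l2, l1, neg_neg, mul_signedSwap_inv_apply hne']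
      split_ifs
      · exact hL i p hkp
      · rw [abs_neg]; exact hL i k le_rfl
      · exact hL i j hj
    · rw [hWk, if_pos rfl]
      exact hne
    · intro j hj
      rw [hWk k, if_pos rfl, hWk j]
      split_ifs
      · exact le_rfl
      · rw [abs_neg]; exact hdom k le_rfl
      · exact hdom j hj
  · have hpk : p = k := by
      simp only [Test.Holds, h1, h2, not_lt] at hT
      exact le_antisymm hT hkp
    subst hpk
    exact (wp_skip ⟨hF, h1, ⟨M, hR, hM, hL⟩, hne, hdom⟩).mono_time (by omega)

/-- Eliminate the entries below and to the right of the pivot in position `(k, k)`. -/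
def Program.eliminate : Program :=
  .seq (.setIdx 4 (.add 1 6)) (.forUp 4
    (.seq (.setRat ⟨4, 8, 8⟩ (.div ⟨0, 4, 1⟩ ⟨0, 1, 1⟩))
      (.seq (.setRat ⟨4, 8, 8⟩ (.sub ⟨7, 8, 8⟩ ⟨4, 8, 8⟩)) (.congruence 4 1))))

/-- The constant `1404 = 26 * 54` combines the growth inside a congruence with the growth from the
beginning of the elimination. -/
theorem wp_eliminate {σ : State} (hH : H.IsSymm) (hb : 1404 * entryBits (matrixBits H) ≤ b)
    (hD : Dominant H k k σ) :
    WP n b .eliminate (n * (12 * n + 11) + 2)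
      (fun τ => τ.idx 1 = k ∧ Core H (k + 1) (τ.updateIdx 1 (k + 1))) σ := by
  obtain ⟨hF, h1, ⟨M, hR, hM, hL⟩, hne, hdom⟩ := hD
  have hs3 : (1 : ℚ) ≤ 3 ^ (k : ℕ) := one_le_pow₀ (by norm_num)
  have hM16 : ∀ i j, |M i j| ≤ 16 * 3 ^ (k : ℕ) := fun i j => by
    refine (hM i j).trans ?_
    split_ifs <;> linarith
  have hsymm := hR.isSymm hH
  have hbW := hR.ratBits_W k.2.le hM16
  obtain ⟨d, hd, hdle, hden⟩ := (hR.exists_den (hR.abs_le k.2.le hM16)).2 k le_rfl hne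
  set W₀ := σ.matrix n 0 with hW₀
  refine (wp_seq (t := 1) (t' := n * ((1 + (1 + (12 * n + 7))) + 2) + 1)
    (wp_setIdx (by norm_num) (by simp [IdxExpr.eval, h1, hF.h6]) ?_)).mono_time
    (le_of_eq (by ring))
  refine (wp_forUp (m₀ := k + 1) (fun r τ => k < r ∧ τ.idx 4 = r ∧ τ.idx 1 = k ∧ Frame n τ ∧
    ∃ M, Eliminating H k W₀ d r M (τ.matrix n 0) (τ.matrix n 1)) (by norm_num) ?_ ?_ k.2
    ?_).mono le_rfl ?_
  · rintro r τ ⟨-, h4, -, hF, -⟩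
    exact ⟨h4, hF.h0⟩
  · rintro r τ hr ⟨hkr, h4, h1, hF, M, hE⟩
    obtain ⟨r, rfl⟩ : ∃ r' : Fin n, (r' : ℕ) = r := ⟨⟨r, hr⟩, rfl⟩
    have hkr' : k < r := Fin.lt_def.2 hkr
    obtain ⟨v1, v2⟩ := hE.multiplier
    have hbits := hE.ratBits_W hbW
    have hcb : ratBits (W₀ r k / W₀ k k) ≤ 2 * entryBits (matrixBits H) := by
      have h5 := ratBits_div_le (W₀ r k) (W₀ k k)
      have h6 := hbW r k
      have h7 := hbW k k
      omega
    have g1 : τ.mem (0, r, k) = W₀ r k := v1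
    have g2 : τ.mem (0, k, k) = W₀ k k := v2
    refine wp_seq (wp_setRat (v := W₀ r k / W₀ k k) (by norm_num)
      (by simp [RatExpr.eval, State.get, State.addr, h1, h4, g1, g2, hne]) (by omega) ?_)
    refine wp_seq (wp_setRat (v := -(W₀ r k / W₀ k k)) (by norm_num)
      (by simp [RatExpr.eval, State.get, State.addr, hF.h8, hF.hz]) (by rw [ratBits_neg]; omega)
      ?_)
    set τ₁ := (τ.updateRat ⟨4, 8, 8⟩ (W₀ r k / W₀ k k)).updateRat ⟨4, 8, 8⟩ (-(W₀ r k / W₀ k k))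
      with hτ₁
    have m1 : ∀ a, a.1 ≠ 4 → τ₁.mem a = τ.mem a := fun a ha => by
      have h3 : a ≠ (4, 0, 0) := fun h => ha (by rw [h])
      simp [hτ₁, State.addr, hF.h8, h3]
    have m4 : τ₁.mem (4, 0, 0) = -(W₀ r k / W₀ k k) := by
      simp [hτ₁, State.addr, hF.h8]
    have w0 : τ₁.matrix n 0 = τ.matrix n 0 := State.matrix_congr fun a ha => m1 a (by omega)
    have w1 : τ₁.matrix n 1 = τ.matrix n 1 := State.matrix_congr fun a ha => m1 a (by omega)
    have hF1 : Frame n τ₁ := hF.congr (fun _ _ => rfl) fun a ha => m1 a (by omega)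
    refine wp_congruence (p := r) (q := k) (b₁ := 54 * entryBits (matrixBits H)) hF1 (by norm_num)
      (by norm_num) h4 h1 hkr'.ne' (by omega) ?_ ?_ ?_ ?_
    · rw [m4, ratBits_neg]; omega
    · rw [w0]; exact hbits
    · rw [w1]
      intro i j
      have := hE.ratBits_L hkr r.2.le hd hdle i j
      omega
    · intro υ u1 u2 u3 u4
      rw [m4, w0] at u3
      rw [m4, w1] at u4
      have hF2 : Frame n υ := hF1.congr (fun r hr => u1 r (by omega)) fun a ha =>
        u2 a (by omega) (by omega) (by omega) (by omega)
      refine ⟨(u1 4 (by norm_num)).trans h4, hF2.h6, Nat.lt_succ_of_lt hkr, by simp,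
        by simpa using (u1 1 (by norm_num)).trans h1,
        hF2.congr (fun r hr => by rw [State.updateIdx_idx, if_neg (by omega)]) fun _ _ => rfl,
        transvection r k (-(W₀ r k / W₀ k k)) * M, ?_⟩
      change Eliminating H k W₀ d (r + 1) _ (υ.matrix n 0) (υ.matrix n 1)
      rw [u3, u4]
      exact hE.step hkr' (by rw [hsymm r k]; exact hdom r hkr'.le) (hden r hkr'.le)
        (by rw [v1, v2])
  · refine ⟨Nat.lt_succ_self _, by simp [IdxExpr.eval, h1, hF.h6], by simpa using h1,
      hF.congr (fun r hr => by rw [State.updateIdx_idx, if_neg (by omega)]) fun _ _ => rfl,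
      M, hR.eliminating hM hL⟩
  · rintro τ ⟨-, -, t1, tF, M', hE⟩
    have hpiv : ∀ i : Fin n, i ≤ k → W₀ i i ≠ 0 := fun i hi => by
      rcases hi.lt_or_eq with h | rfl
      · exact hR.pivot i h
      · exact hne
    obtain ⟨e1, e2, e3⟩ := hE.reduced hd hdle hsymm hR.diag hpiv (fun i => hbW i i)
    exact ⟨t1, tF.congr (fun r hr => by rw [State.updateIdx_idx, if_neg (by omega)])
      fun _ _ => rfl, by simp, M', e1, e2, e3⟩

end RatRAM

/-! ### The complete program -/

namespace RatRAM

open Matrix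

variable {n b : ℕ}

theorem WP.of_good {P : Program} {t : ℕ} {Q : State → Prop} {σ : State}
    (h : Good n b σ → WP n b P t Q σ) : WP n b P t Q σ := fun hσ => h hσ hσ

/-- One stage: find a pivot, move it into place, and eliminate. If the trailing block is
zero, register `1` is set to `n - 1`, which ends the reduction. -/
def Program.stage : Program :=
  .seq .search (.ite (.ratLe ⟨6, 8, 8⟩ ⟨7, 8, 8⟩) (.setIdx 1 (.reg 7))
    (.seq .enlarge (.seq .exchange (.seq .eliminate (.setIdx 1 (.add 1 6))))))

/-- The situation when the reduction is complete. -/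
structure Done (H : Matrix (Fin n) (Fin n) ℚ) (σ : State) : Prop where
  frame : Frame n σ
  idx : σ.idx 1 = n - 1
  result : ∃ M : Matrix (Fin n) (Fin n) ℚ, M * σ.matrix n 1 = 1 ∧ σ.matrix n 0 = M * H * Mᵀ ∧
    (σ.matrix n 0).IsDiag ∧ (∀ i j, |M i j| ≤ 3 ^ (n - 1)) ∧ ∀ i j, |σ.matrix n 1 i j| ≤ 2 ^ n

variable {H : Matrix (Fin n) (Fin n) ℚ} {k : ℕ}

theorem Core.done {σ : State} (hC : Core H (n - 1) σ) : Done H σ := by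
  obtain ⟨hF, h1, M, hR, hM, hL⟩ := hC
  refine ⟨hF, h1, M, hR.inv, hR.eq, fun i j hij => hR.diag i j hij ?_, hM, fun i j => ?_⟩
  · have : (i : ℕ) ≠ j := fun h => hij (Fin.ext h)
    omega
  · by_cases hj : (j : ℕ) < n - 1
    · exact hR.absL i j hj
    · exact (hL i j (not_lt.1 hj)).trans (pow_le_pow_right₀ (by norm_num) (Nat.sub_le _ _))

/-- A bound for the number of steps of one stage. -/
def stageTime (n : ℕ) : ℕ := 21 * n ^ 2 + 63 * n + 46

theorem wp_stage {σ : State} (hH : H.IsSymm) (hb : 1404 * entryBits (matrixBits H) ≤ b)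
    (hk : k < n - 1) (hC : Core H k σ) :
    WP n b .stage (stageTime n) (fun τ => Core H (k + 1) τ ∨ Done H τ) σ := by
  have hkn : k < n := by omega
  obtain ⟨hF, h1, M, hR, hM, hL⟩ := hC
  have h3 := three_le_entryBits (matrixBits H)
  have hbits := hR.ratBits_W hkn.le (fun i j => (hM i j).trans
    (by linarith [one_le_pow₀ (by norm_num : (1 : ℚ) ≤ 3) (n := k)]))
  refine (wp_seq (t := n * (9 * n + 4) + 5) (t' := ((12 * n + 12) + ((36 * n + 25) +
    ((n * (12 * n + 11) + 2) + 1))) + 1) (wp_search hF h1 hkn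
    (fun i j => (hbits i j).trans (by omega)) (by omega) ?_)).mono_time
    (le_of_eq (by unfold stageTime; ring))
  rintro τ t1 t2 ⟨p, q, hp, hq, hkp, hpq, hle, hmax⟩
  have w0 : τ.matrix n 0 = σ.matrix n 0 :=
    State.matrix_congr fun a ha => t2 a (by omega) (by omega)
  have w1 : τ.matrix n 1 = σ.matrix n 1 :=
    State.matrix_congr fun a ha => t2 a (by omega) (by omega)
  have hF1 : Frame n τ := hF.congr (fun r hr => t1 r (by omega) (by omega) (by omega) (by omega))
    fun a ha => t2 a (by omega) (by omega)
  have hk1 : τ.idx 1 = k :=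
    (t1 1 (by norm_num) (by norm_num) (by norm_num) (by norm_num)).trans h1
  have hsymm := hR.isSymm hH
  have hmax' : ∀ i j : Fin n, k ≤ i → k ≤ j → |σ.matrix n 0 i j| ≤ τ.mem (6, 0, 0) := by
    intro i j hi hj
    rcases le_total i j with h | h
    · exact hmax i j hi h
    · rw [hsymm i j]
      exact hmax j i hj h
  refine wp_ite (fun hT => ?_) fun hT => ?_
  · have hT' : τ.mem (6, 0, 0) ≤ 0 := by
      simpa [Test.Holds, State.get, State.addr, hF1.h8, hF1.hz] using hT
    refine (wp_setIdx (by norm_num) (by simp [IdxExpr.eval, hF1.h7]; omega)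
      (Or.inr ?_)).mono_time (by omega)
    refine ⟨hF1.congr (fun r hr => by rw [State.updateIdx_idx, if_neg (by omega)])
      fun _ _ => rfl, by simp [IdxExpr.eval, hF1.h7], ?_⟩
    change ∃ M : Matrix (Fin n) (Fin n) ℚ, M * τ.matrix n 1 = 1 ∧ τ.matrix n 0 = M * H * Mᵀ ∧
      (τ.matrix n 0).IsDiag ∧ (∀ i j, |M i j| ≤ 3 ^ (n - 1)) ∧ ∀ i j, |τ.matrix n 1 i j| ≤ 2 ^ n
    rw [w0, w1]
    refine ⟨M, hR.inv, hR.eq, fun i j hij => ?_,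
      fun i j => (hM i j).trans (pow_le_pow_right₀ (by norm_num) hk.le), fun i j => ?_⟩
    · by_cases h : (i : ℕ) < k ∨ (j : ℕ) < k
      · exact hR.diag i j hij h
      · push Not at h
        exact abs_eq_zero.1 (le_antisymm ((hmax' i j h.1 h.2).trans hT') (abs_nonneg _))
    · by_cases hj : (j : ℕ) < k
      · exact hR.absL i j hj
      · exact (hL i j (not_lt.1 hj)).trans (pow_le_pow_right₀ (by norm_num) hkn.le)
  · have hT' : 0 < τ.mem (6, 0, 0) := by
      simpa [Test.Holds, State.get, State.addr, hF1.h8, hF1.hz] using hT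
    have hC1 : Core H ((⟨k, hkn⟩ : Fin n) : ℕ) τ := ⟨hF1, hk1, M, by rw [w0, w1]; exact hR, hM,
      by rw [w1]; exact hL⟩
    refine wp_seq ((wp_enlarge hH (by omega) hC1 hp hq (Fin.le_def.2 hkp) hpq
      (fun i j hi hj => by rw [w0]; exact (hmax' i j hi hj).trans hle) ?_).mono le_rfl ?_)
    · rw [w0]
      exact abs_pos.1 (hT'.trans_le hle)
    rintro υ ⟨u2, hD⟩
    refine wp_seq ((wp_exchange (by omega) hD u2 (Fin.le_def.2 hkp)).mono le_rfl ?_)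
    intro ω hD'
    refine wp_seq ((wp_eliminate hH hb hD').mono le_rfl ?_)
    rintro ρ ⟨r1, hC2⟩
    have r6 : ρ.idx 6 = 1 := by simpa using hC2.frame.h6
    have hev : IdxExpr.eval ρ (.add 1 6) = k + 1 := by simp [IdxExpr.eval, r1, r6]
    refine wp_setIdx (by norm_num) (by omega) (Or.inl ?_)
    rw [hev]
    exact hC2

/-- Set up the constant registers and let `L` be the identity matrix. -/
def Program.setup : Program :=
  .seq (.setIdx 6 (.const 1)) (.seq (.setIdx 7 (.sub 0 6))
    (.forUp 4 (.setRat ⟨1, 4, 4⟩ (.const 1))))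

/-- Copy the diagonal of array `0` to array `2`. -/
def Program.finish : Program :=
  .seq (.setIdx 4 (.const 0)) (.forUp 4 (.setRat ⟨2, 4, 4⟩ (.cell ⟨0, 4, 4⟩)))

/-- The decomposition `H = L D Lᵀ` by symmetric elimination with pivoting. After `n - 1` stages the
last row needs no treatment. -/
def Program.ldl : Program :=
  .seq .setup (.seq (.loop (.idxLt 1 7) .stage) .finish)

theorem input_mem (H : Matrix (Fin n) (Fin n) ℚ) (a : ℕ × ℕ × ℕ) :
    (State.input H).mem a =
      ∑ i : Fin n, ∑ j : Fin n, if (0, (i : ℕ), (j : ℕ)) = a then H i j else 0 := by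
  simp [State.input, Finsupp.finsetSum_apply, Finsupp.single_apply]

theorem input_mem_zero (H : Matrix (Fin n) (Fin n) ℚ) (i j : Fin n) :
    (State.input H).mem (0, i, j) = H i j := by
  rw [input_mem, Finset.sum_eq_single i, Finset.sum_eq_single j]
  · simp
  · intro j' _ hj
    simp [Fin.val_inj, hj]
  · simp
  · intro i' _ hi
    simp [Fin.val_inj, hi]
  · simp

theorem exists_of_input_mem_ne_zero {a : ℕ × ℕ × ℕ} (h : (State.input H).mem a ≠ 0) :
    ∃ i j : Fin n, a = (0, (i : ℕ), (j : ℕ)) := by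
  rw [input_mem] at h
  obtain ⟨i, -, hi⟩ := Finset.exists_ne_zero_of_sum_ne_zero h
  obtain ⟨j, -, hj⟩ := Finset.exists_ne_zero_of_sum_ne_zero hi
  refine ⟨i, j, ?_⟩
  by_contra hne
  exact hj (if_neg fun h => hne h.symm)

theorem input_mem_of_ne {a : ℕ × ℕ × ℕ} (ha : a.1 ≠ 0) : (State.input H).mem a = 0 := by
  by_contra h
  obtain ⟨i, j, rfl⟩ := exists_of_input_mem_ne_zero h
  exact ha rfl

theorem input_idx (H : Matrix (Fin n) (Fin n) ℚ) (r : ℕ) :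
    (State.input H).idx r = if r = 0 then n else 0 := by
  simp [State.input, Finsupp.single_apply, eq_comm]

theorem good_input (hb : matrixBits H ≤ b) (hb2 : 2 ≤ b) : Good n b (State.input H) where
  idx_lt i hi := by
    rw [input_idx] at hi
    split_ifs at hi with h
    · omega
    · exact absurd rfl hi
  idx_le i := by
    rw [input_idx]
    split_ifs <;> omega
  mem_lt a ha := by
    obtain ⟨i, j, rfl⟩ := exists_of_input_mem_ne_zero ha
    exact ⟨by norm_num, by simp only; omega, by simp only; omega⟩
  mem_le a := by
    by_cases ha : (State.input H).mem a = 0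
    · rwa [ha, ratBits_zero]
    · obtain ⟨i, j, rfl⟩ := exists_of_input_mem_ne_zero ha
      rw [input_mem_zero]
      exact (ratBits_le_matrixBits H i j).trans hb

theorem reduced_zero (H : Matrix (Fin n) (Fin n) ℚ) : Reduced H 0 1 H 1 where
  inv := Matrix.one_mul 1
  eq := by simp
  factor := ⟨1, 1, by simp, det_one, fun _ _ _ => rfl⟩
  diag i j _ h := by omega
  pivot i h := by omega
  integral i j _ := by
    rw [one_apply]
    split_ifs
    · exact ⟨1, by simp⟩
    · exact ⟨0, by simp⟩
  bitsW i h := by omega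
  bitsL i j h := by omega
  absL i j h := by omega

theorem wp_setup (hb : 3 ≤ b) :
    WP n b .setup (3 * n + 3) (Core H 0) (State.input H) := by
  refine (wp_seq (t := 1) (t' := 1 + (n * (1 + 2) + 1)) (wp_setIdx (by norm_num)
    (by simp [IdxExpr.eval]) ?_)).mono_time (by omega)
  refine wp_seq (wp_setIdx (by norm_num) (by simp [IdxExpr.eval, input_idx]; omega) ?_)
  refine (wp_forUp (m₀ := 0) (fun m τ => τ.idx 4 = m ∧
    (∀ r, r ≠ 4 → τ.idx r = if r = 0 then n else if r = 6 then 1 else if r = 7 then n - 1 else 0) ∧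
    ∀ a, τ.mem a = if a.1 = 1 ∧ a.2.1 = a.2.2 ∧ a.2.1 < m then 1 else (State.input H).mem a)
    (by norm_num) ?_ ?_ (Nat.zero_le _) ?_).mono le_rfl ?_
  · rintro m τ ⟨h4, hi, -⟩
    exact ⟨h4, hi 0 (by norm_num)⟩
  · rintro m τ hm ⟨h4, hi, ha⟩
    refine wp_setRat (v := 1) (by norm_num) rfl (by simpa using hb) ⟨h4, hi 6 (by norm_num), ?_,
      ?_, ?_⟩
    · simp
    · intro r hr
      simpa [hr] using hi r hr
    · rintro ⟨x, y, z⟩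
      simp only [State.updateIdx_mem, State.updateRat_mem, State.addr, h4, ha, Prod.mk.injEq]
      by_cases hx : x = 1 ∧ y = m ∧ z = m
      · obtain ⟨rfl, rfl, rfl⟩ := hx
        simp
      · rw [if_neg hx]
        refine if_congr ?_ rfl rfl
        omega
  · refine ⟨by simp [input_idx], fun r hr => ?_, fun a => by simp⟩
    simp only [State.updateIdx_idx, IdxExpr.eval, input_idx]
    norm_num
    split_ifs <;> omega
  · rintro τ ⟨h4, hi, ha⟩
    have w0 : τ.matrix n 0 = H := by
      ext i j
      simp [State.matrix, ha, input_mem_zero]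
    have w1 : τ.matrix n 1 = 1 := by
      ext i j
      rw [State.matrix, of_apply, ha, one_apply]
      by_cases hij : i = j
      · simp [hij]
      · have : (i : ℕ) ≠ j := fun h => hij (Fin.ext h)
        rw [if_neg hij, if_neg (by simp [this]), input_mem_of_ne (by simp)]
    refine ⟨⟨hi 0 (by norm_num), hi 6 (by norm_num), hi 7 (by norm_num), hi 8 (by norm_num), ?_,
      ?_⟩, hi 1 (by norm_num), 1, ?_, ?_, ?_⟩
    · rw [ha, if_neg (by simp), input_mem_of_ne (by simp)]
    · intro a h2
      rw [ha, if_neg (by omega), input_mem_of_ne (by omega)]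
    · rw [w0, w1]
      exact reduced_zero H
    · intro i j
      rw [one_apply]
      split_ifs <;> simp
    · intro i j _
      rw [w1, one_apply]
      split_ifs <;> simp

theorem wp_finish {σ : State} (hF : Frame n σ) (hdiag : (σ.matrix n 0).IsDiag) :
    WP n b .finish (3 * n + 2)
      (fun τ => τ.matrix n 1 = σ.matrix n 1 ∧ τ.matrix n 2 = σ.matrix n 0) σ := by
  refine WP.of_good fun hG => ?_
  refine (wp_seq (t := 1) (t' := n * (1 + 2) + 1) (wp_setIdx (by norm_num)
    (by simp [IdxExpr.eval]) ?_)).mono_time (by omega)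
  refine (wp_forUp (m₀ := 0) (fun m τ => τ.idx 4 = m ∧ τ.idx 0 = n ∧ τ.idx 6 = 1 ∧
    ∀ a, τ.mem a = if a.1 = 2 ∧ a.2.1 = a.2.2 ∧ a.2.1 < m then σ.mem (0, a.2.1, a.2.2)
      else σ.mem a) (by norm_num) ?_ ?_ (Nat.zero_le _) ?_).mono le_rfl ?_
  · rintro m τ ⟨h4, h0, -⟩
    exact ⟨h4, h0⟩
  · rintro m τ hm ⟨h4, h0, h6, ha⟩
    refine wp_setRat (v := σ.mem (0, m, m)) (by norm_num)
      (by simp [RatExpr.eval, State.get, State.addr, h4, ha]) (hG.mem_le _)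
      ⟨h4, h6, ?_, ?_, ?_, ?_⟩
    · simp
    · simpa using h0
    · simpa using h6
    · rintro ⟨x, y, z⟩
      simp only [State.updateIdx_mem, State.updateRat_mem, State.addr, h4, ha, Prod.mk.injEq]
      by_cases hx : x = 2 ∧ y = m ∧ z = m
      · obtain ⟨rfl, rfl, rfl⟩ := hx
        simp
      · rw [if_neg hx]
        refine if_congr ?_ rfl rfl
        omega
  · exact ⟨by simp [IdxExpr.eval], by simpa using hF.h0, by simpa using hF.h6, fun a => by simp⟩
  · rintro τ ⟨-, -, -, ha⟩
    refine ⟨State.matrix_congr fun a h => by rw [ha, if_neg (by omega)], ?_⟩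
    ext i j
    rw [State.matrix, of_apply, ha]
    by_cases hij : i = j
    · simp [hij, State.matrix]
    · have : (i : ℕ) ≠ j := fun h => hij (Fin.ext h)
      rw [if_neg (by simp [this]), hF.hD _ rfl, hdiag hij]

/-- A bound for the number of steps of the whole program. -/
def totalTime (n : ℕ) : ℕ := (3 * n + 3) + ((n * (stageTime n + 1) + 1) + (3 * n + 2))

theorem wp_ldl (hH : H.IsSymm) (hb : 1404 * entryBits (matrixBits H) ≤ b) :
    WP n b .ldl (totalTime n) (fun τ => ∃ M : Matrix (Fin n) (Fin n) ℚ, M * τ.matrix n 1 = 1 ∧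
      τ.matrix n 2 = M * H * Mᵀ ∧ (τ.matrix n 2).IsDiag ∧ (∀ i j, |M i j| ≤ 3 ^ (n - 1)) ∧
      ∀ i j, |τ.matrix n 1 i j| ≤ 2 ^ n) (State.input H) := by
  have h3 := three_le_entryBits (matrixBits H)
  refine wp_seq ((wp_setup (H := H) (by omega)).mono le_rfl ?_)
  intro σ hC
  refine wp_seq ((wp_loop (t := stageTime n)
    (fun σ => (∃ k ≤ n - 1, Core H k σ) ∨ Done H σ) (fun σ => n - 1 - σ.idx 1) ?_
    (Or.inl ⟨0, Nat.zero_le _, hC⟩)).mono ?_ ?_)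
  · rintro τ (⟨k, hk, hC⟩ | hD) hT
    · simp only [Test.Holds, hC.idx, hC.frame.h7] at hT
      refine (wp_stage hH hb hT hC).mono le_rfl ?_
      rintro υ (hC' | hD)
      · exact ⟨Or.inl ⟨k + 1, hT, hC'⟩, by simp only [hC.idx, hC'.idx]; omega⟩
      · exact ⟨Or.inr hD, by simp only [hC.idx, hD.idx]; omega⟩
    · simp only [Test.Holds, hD.idx, hD.frame.h7, lt_self_iff_false] at hT
  · exact Nat.add_le_add_right (Nat.mul_le_mul_right _ (by omega)) _
  · rintro τ ⟨hτ, hT⟩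
    have hD : Done H τ := by
      rcases hτ with ⟨k, hk, hC⟩ | hD
      · simp only [Test.Holds, hC.idx, hC.frame.h7] at hT
        obtain rfl : k = n - 1 := by omega
        exact hC.done
      · exact hD
    obtain ⟨hF, -, M, d1, d2, d3, d4, d5⟩ := hD
    refine (wp_finish hF d3).mono le_rfl ?_
    rintro υ ⟨u1, u2⟩
    rw [u1, u2]
    exact ⟨M, d1, d2, d3, d4, d5⟩

theorem spaceBound_mono {n n' : ℕ} (h : n ≤ n') (b : ℕ) : spaceBound n b ≤ spaceBound n' b := by
  unfold spaceBound
  gcongr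

end RatRAM

theorem frobeniusNorm_le {n : ℕ} {A : Matrix (Fin n) (Fin n) ℚ} {B : ℕ}
    (hA : ∀ i j, |A i j| ≤ (B : ℚ)) (hB : (n * B) ^ 2 ≤ (5 * n) ^ n) :
    frobeniusNorm A ≤ (5 * (n : ℝ)) ^ ((n : ℝ) / 2) := by
  have h1 : ∑ i, ∑ j, (A i j : ℝ) ^ 2 ≤ (5 * (n : ℝ)) ^ n := by
    have h2 : ∀ i j, (A i j : ℝ) ^ 2 ≤ (B : ℝ) ^ 2 := fun i j => by
      rw [sq_le_sq, Nat.abs_cast]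
      exact_mod_cast hA i j
    calc ∑ i, ∑ j, (A i j : ℝ) ^ 2 ≤ ∑ _i : Fin n, ∑ _j : Fin n, (B : ℝ) ^ 2 :=
          Finset.sum_le_sum fun i _ => Finset.sum_le_sum fun j _ => h2 i j
      _ = ((n : ℝ) * B) ^ 2 := by
          simp
          ring
      _ ≤ (5 * (n : ℝ)) ^ n := by exact_mod_cast hB
  have h0 : (0 : ℝ) ≤ 5 * n := by positivity
  rw [frobeniusNorm, div_eq_mul_one_div, Real.rpow_mul h0, Real.rpow_natCast, ← Real.sqrt_eq_rpow]
  exact Real.sqrt_le_sqrt h1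

theorem sq_mul_two_pow_le (n : ℕ) : (n * 2 ^ n) ^ 2 ≤ (5 * n) ^ n := by
  rcases n with _ | _ | n
  · simp
  · norm_num
  · have h : (2 ^ (n + 2)) ^ 2 ≤ 5 ^ (n + 2) := by
      rw [← pow_mul, mul_comm, pow_mul]
      exact Nat.pow_le_pow_left (by norm_num) _
    rw [mul_pow, mul_pow, mul_comm]
    exact Nat.mul_le_mul h (Nat.pow_le_pow_right (by omega) (by omega))

theorem sq_mul_three_pow_le (n : ℕ) : (n * 3 ^ (n - 1)) ^ 2 ≤ (5 * n) ^ n := by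
  rcases n with _ | _ | n
  · simp
  · norm_num
  -- From dimension two on, `9 ≤ 5 * n` bounds all but one of the factors `9`, and `9 ≤ 25`.
  · have h1 : (n + 2) ^ 2 * (3 ^ (n + 1)) ^ 2 = 9 ^ n * (9 * (n + 2) ^ 2) := by
      rw [← pow_mul, mul_comm (n + 1) 2, pow_mul, pow_succ]
      norm_num
      ring
    have h2 : (5 * (n + 2)) ^ (n + 2) = (5 * (n + 2)) ^ n * (25 * (n + 2) ^ 2) := by
      rw [pow_add]
      ring
    rw [mul_pow]
    simp only [Nat.add_succ_sub_one, Nat.add_assoc, Nat.reduceAdd]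
    rw [h1, h2]
    exact Nat.mul_le_mul (Nat.pow_le_pow_left (by omega) n) (Nat.mul_le_mul_right _ (by norm_num))

theorem mainTheorem4 :
    ∃ P : RatRAM.Program,
      P.FindsInStronglyPolynomialTime
        (fun {n : ℕ} (H : Matrix (Fin n) (Fin n) ℚ) => H.IsSymm)
        (fun {n : ℕ} (H L D : Matrix (Fin n) (Fin n) ℚ) =>
          IsUnit L ∧ D.IsDiag ∧ H = L * D * L.transpose ∧
            frobeniusNorm L ≤ (5 * (n : ℝ)) ^ ((n : ℝ) / 2) ∧
            frobeniusNorm L⁻¹ ≤ (5 * (n : ℝ)) ^ ((n : ℝ) / 2)) := by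
  open RatRAM Polynomial in
  refine ⟨.ldl, (3 * X + 3) + ((X * ((21 * X ^ 2 + 63 * X + 46) + 1) + 1) + (3 * X + 2)),
    9 * (9 + (X + 1)) + 9 * ((X + 2) * (X + 2)) * (9 + (X + 2) + (X + 2) +
      1404 * (2 * ((8 * X + 8) * (X + 1) + X) + (7 * X + 8) + 3)), ?_⟩
  intro n H hH
  have hn := le_matrixBits H
  have hbits : RatRAM.matrixBits H ≤ 1404 * RatRAM.entryBits (RatRAM.matrixBits H) := by
    unfold RatRAM.entryBits RatRAM.wBits
    omega
  obtain ⟨τ, t, s, hE, ht, hs, -, M, hML, hW, hD, hM, hL⟩ :=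
    RatRAM.wp_ldl hH le_rfl (RatRAM.good_input hbits
      (by have := RatRAM.three_le_entryBits (RatRAM.matrixBits H); omega))
  refine ⟨t, s, τ, hE, ht.trans (le_of_eq ?_),
    (hs.trans (RatRAM.spaceBound_mono hn _)).trans (le_of_eq ?_), ?_, hD, ?_, ?_, ?_⟩
  · simp [RatRAM.totalTime, RatRAM.stageTime]
  · simp [RatRAM.spaceBound, RatRAM.entryBits, RatRAM.denBits, RatRAM.wBits]
  · exact IsUnit.of_mul_eq_one_right M hML
  · have hLM := mul_eq_one_comm.1 hML
    rw [hW]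
    have h2 : M.transpose * (τ.matrix n 1).transpose = 1 := by
      rw [← Matrix.transpose_mul, hLM, Matrix.transpose_one]
    simp only [← Matrix.mul_assoc, hLM, Matrix.one_mul]
    rw [Matrix.mul_assoc, h2, Matrix.mul_one]
  · exact frobeniusNorm_le (B := 2 ^ n) (by exact_mod_cast hL) (sq_mul_two_pow_le n)
  · rw [Matrix.inv_eq_left_inv hML]
    exact frobeniusNorm_le (B := 3 ^ (n - 1)) (by exact_mod_cast hM) (sq_mul_three_pow_le n)
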